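/- Let $T=\{0,1/2,1/3,\ldots,1/n,\ldots\}$. Let $\lambda_j>0$ and $f_j,g_j\in(0,1)$, $j\ge 2$, satisfy $$\lim_{n\to\infty}\lambda_n=0,\qquad \sum_{j=2}^\infty\frac{1-f_j}{\lambda_j}<1,\qquad \sum_{j=2}^\infty\frac{1-g_j}{\lambda_j}<1,$$ put $\lambda_0=0$, $f_0=g_0=1$, and $G_{i,j}=\lambda_i\delta_{i,j}+1+f_ig_j$ for $i,j\in\{0,2,3,\ldots\}$. Define the kernel $U$ on $T\times T$ by $U(0,0)=G_{0,0}=2$ and, for $i,j\ge2$, $U(0,1/j)=G_{0,j}=1+g_j$, $U(1/i,0)=G_{i,0}=1+f_i$, $U(1/i,1/j)=G_{i,j}$. For $\alpha>0$, an $\alpha$-permanental process with kernel $U$ is a nonnegative stochastic process $X_{(\alpha)}=\{X_{(\alpha),t},t\in T\}$ such that for all $t_1,\ldots,t_n\in T$ and $s_1,\ldots,s_n\ge 0$ $$E\Big(e^{-\sum_{i=1}^n s_iX_{(\alpha),t_i}}\Big)=\frac1{|I+KS|^{\alpha}},\qquad K=\{U(t_i,t_j)\}_{i,j=1}^n,\quad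 S=\mathrm{diag}(s_1,\ldots,s_n),$$ where $|\cdot|$ is the determinant. **Theorem 1.4.** If $\lim_{n\to\infty}\lambda_n\log n=0$, then for every integer $k\ge1$ and every $k/2$-permanental process $X_{(k/2)}$ with kernel $U$, $$\limsup_{n\to\infty}\frac{|X_{(k/2),1/n}-X_{(k/2),0}|}{(\lambda_n\log n)^{1/2}}=2X_{(k/2),0}^{1/2}\quad\text{a.s.},$$ $$\limsup_{n\to\infty}\frac{X_{(k/2),1/n}-X_{(k/2),0}}{(\lambda_n\log n)^{1/2}}=2X_{(k/2),0}^{1/2}\quad\text{a.s.},$$ and $$\liminf_{n\to\infty}\frac{X_{(k/2),1/n}-X_{(k/2),0}}{(\lambda_n\log n)^{1/2}}=-2X_{(k/2),0}^{1/2}\quad\text{a.s.}$$ -/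

import Mathlib

open MeasureTheory

namespace KolmogorovPermanental

/-- The index set `T = {0, 1/2, 1/3, …, 1/n, …}`, a subset of the real line. -/
def T : Set ℝ := {0} ∪ {s : ℝ | ∃ n : ℕ, 2 ≤ n ∧ s = 1 / (n : ℝ)}

/-- The point `0` of `T`. -/
def zeroPt : T := ⟨0, Or.inl rfl⟩

/-- The point `1/n` of `T`, for `n ≥ 2` (the value at `n = 0, 1` is immaterial). -/
noncomputable def invPt (n : ℕ) : T :=
  if h : 2 ≤ n then ⟨1 / (n : ℝ), Or.inr ⟨n, h, rfl⟩⟩ else zeroPt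

/-- The label of a point of `T`: the point `0` has label `0`, the point `1/n` has label `n`
(recall that `0⁻¹ = 0`). -/
noncomputable def label (s : T) : ℕ := ⌊(s : ℝ)⁻¹⌋₊

theorem label_zeroPt : label zeroPt = 0 := by
  simp [label, zeroPt]

theorem label_invPt {n : ℕ} (hn : 2 ≤ n) : label (invPt n) = n := by
  simp [label, invPt, hn]

/-- The infinite matrix `G i j = lam i * δ i j + 1 + f i * g j`; only the indices
`0, 2, 3, …` are used. -/
def G (lam f g : ℕ → ℝ) (i j : ℕ) : ℝ :=
  (if i = j then lam i else 0) + 1 + f i * g j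

/-- The kernel `U` on `T`: `U(0,0) = G 0 0`, `U(0,1/j) = G 0 j`, `U(1/i,0) = G i 0`,
`U(1/i,1/j) = G i j`. -/
noncomputable def U (lam f g : ℕ → ℝ) (s t : T) : ℝ := G lam f g (label s) (label t)

/-- The standing assumptions on the sequences `lam`, `f`, `g`. -/
structure Admissible (lam f g : ℕ → ℝ) : Prop where
  lam_zero : lam 0 = 0
  f_zero : f 0 = 1
  g_zero : g 0 = 1
  f_mem : ∀ i, 2 ≤ i → 0 < f i ∧ f i < 1
  g_mem : ∀ i, 2 ≤ i → 0 < g i ∧ g i < 1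
  lam_pos : ∀ i, 2 ≤ i → 0 < lam i
  lam_tendsto : Filter.Tendsto lam Filter.atTop (nhds 0)
  f_summable : Summable (fun j : ℕ => (1 - f (j + 2)) / lam (j + 2))
  f_sum_lt : ∑' j : ℕ, (1 - f (j + 2)) / lam (j + 2) < 1
  g_summable : Summable (fun j : ℕ => (1 - g (j + 2)) / lam (j + 2))
  g_sum_lt : ∑' j : ℕ, (1 - g (j + 2)) / lam (j + 2) < 1

/-- `X = (X_1, …, X_n)` is an `α`-permanental random variable with kernel `K`: it takes values
in the nonnegative orthant and its Laplace transform at `(s_1, …, s_n)`, `s_i ≥ 0`, is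
`1 / |I + K S|^α` with `S = diag(s_1, …, s_n)`.  The left side is positive, so the
identity forces the determinant to have no zero on the orthant, hence to be positive there. -/
structure IsPermanentalVector {Ω : Type*} [MeasurableSpace Ω] (P : Measure Ω) (α : ℝ) {n : ℕ}
    (K : Matrix (Fin n) (Fin n) ℝ) (X : Fin n → Ω → ℝ) : Prop where
  alpha_pos : 0 < α
  measurable : ∀ i, Measurable (X i)
  nonneg : ∀ i ω, 0 ≤ X i ω
  laplace : ∀ s : Fin n → ℝ, (∀ i, 0 ≤ s i) →
    ∫ ω, Real.exp (-∑ i, s i * X i ω) ∂P = 1 / ((1 + K * Matrix.diagonal s).det) ^ α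

/-- `X = {X_t, t ∈ I}` is an `α`-permanental process with kernel `K`: all its finite dimensional
marginals `(X_{t_1}, …, X_{t_n})` are `α`-permanental with kernel `{K(t_i,t_j)}`. -/
def IsPermanentalProcess {Ω : Type*} [MeasurableSpace Ω] (P : Measure Ω) (α : ℝ) {I : Type*}
    (K : I → I → ℝ) (X : I → Ω → ℝ) : Prop :=
  ∀ (n : ℕ) (t : Fin n → I),
    IsPermanentalVector P α (Matrix.of fun i j => K (t i) (t j)) (fun i => X (t i))

end KolmogorovPermanental

/-! The process cannot be analysed directly, since the kernel is not symmetric and no Gaussian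
representation is at hand. Instead, its law near `0` is bounded below by an explicit law of nearly
full mass, for which the oscillation is a statement about independent normal variables.

Put `φ = 1 - f`, `γ = 1 - g`, `w_j = s_j / (1 + lam_j s_j)`, and look only at the points `0, 1/n, …,
1/(n+M-1)`. The kernel is a diagonal plus rank two, so the determinant is `∏ (1 + lam_j s_j)` times
`(1 + s_0 + ∑ w_j)(2 + ∑ w_j φ_j γ_j) - (1 + ∑ w_j φ_j)(1 + ∑ w_j γ_j)`. Each `w_j` equals `(1 -
y_j) / lam_j`, where `y_j = 1 / (1 + lam_j s_j)` is an exponential Laplace transform. Because the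
tails `p`, `q` of `∑ φ_j / lam_j`, `∑ γ_j / lam_j` are below `1`, this bracket factors as `(2 + r) D
(1 - u1)(1 - u3)`, with `r` the tail of `∑ φ_j γ_j / lam_j`, `D = c + s_0 + ∑ e_j w_j`, and `u1`,
`u3` Laplace transforms of measures of mass below `1`. Expanding `(1 - u) ^ (-α)` in a series with
nonnegative coefficients writes the joint transform as a constant times `∏ y_j ^ α * (c / D) ^ α`,
plus the transform of a positive measure (`laplace_decomposition`). By uniqueness (`ext_of_laplace`)
this is an inequality between measures (`Admissible.minorant_le`).

For `α = (d + 1) / 2` the main term is the law of a gamma variable `Y` together with, given `Y`,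
independent noncentral chi-squares. Their increments from `Y` are `√lam_j Z_j √(2 Y e_j)` plus lower
order terms, and `limsup Z_j / √(log j) = √2`, which yields the constant `√2 * √(2 Y) = 2 √Y`
(`ae_minorant_oscillation`).

The constants `p`, `q`, `r` are tails of the infinite series, so the minorant does not depend on `M`
and `M` may tend to infinity. An asymptotic property that is almost sure for every minorant thus has
probability at least the mass `((2 + r) c) ^ (-α)`, which tends to `1` as `n → ∞`
(`Admissible.ae_eventually_of_minorant`, `Admissible.ae_frequently_of_minorant`). -/

namespace KolmogorovPermanental

open Filter Topology ProbabilityTheory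
open scoped NNReal ENNReal

/-! ### Laplace transforms of measures on the orthant -/

/-- `F` is the Laplace transform of a measure on the orthant `ι → ℝ≥0`. -/
def IsLaplaceTransform {ι : Type*} [Fintype ι] (F : (ι → ℝ≥0) → ℝ) : Prop :=
  (∀ s, 0 ≤ F s) ∧ ∃ μ : Measure (ι → ℝ≥0), ∀ s,
    ∫⁻ x, ENNReal.ofReal (Real.exp (-∑ i, (s i : ℝ) * x i)) ∂μ = ENNReal.ofReal (F s)

section LaplaceTransform

variable {ι : Type*} [Fintype ι]

theorem measurable_laplaceKernel (s : ι → ℝ≥0) :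
    Measurable fun x : ι → ℝ≥0 => ENNReal.ofReal (Real.exp (-∑ i, (s i : ℝ) * x i)) := by
  fun_prop

theorem laplaceKernel_le_one (s x : ι → ℝ≥0) :
    Real.exp (-∑ i, (s i : ℝ) * x i) ≤ 1 := by
  rw [Real.exp_le_one_iff, neg_nonpos]
  exact Finset.sum_nonneg fun i _ => by positivity

theorem isFiniteMeasure_of_laplace {F : (ι → ℝ≥0) → ℝ} {μ : Measure (ι → ℝ≥0)}
    (h : ∀ s, ∫⁻ x, ENNReal.ofReal (Real.exp (-∑ i, (s i : ℝ) * x i)) ∂μ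
      = ENNReal.ofReal (F s)) : IsFiniteMeasure μ := by
  refine ⟨?_⟩
  have := h 0
  simp only [Pi.zero_apply, NNReal.coe_zero, zero_mul, Finset.sum_const_zero, neg_zero,
    Real.exp_zero, ENNReal.ofReal_one, lintegral_const, one_mul] at this
  rw [this]
  exact ENNReal.ofReal_lt_top

namespace IsLaplaceTransform

variable {F H : (ι → ℝ≥0) → ℝ}

theorem congr (hF : IsLaplaceTransform F) (h : ∀ s, F s = H s) : IsLaplaceTransform H := by
  rwa [← funext h]

theorem const {c : ℝ} (hc : 0 ≤ c) : IsLaplaceTransform (fun _ : ι → ℝ≥0 => c) := by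
  refine ⟨fun _ => hc, ENNReal.ofReal c • Measure.dirac 0, fun s => ?_⟩
  rw [lintegral_smul_measure, lintegral_dirac' _ (measurable_laplaceKernel s)]
  simp

theorem add (hF : IsLaplaceTransform F) (hH : IsLaplaceTransform H) :
    IsLaplaceTransform (fun s => F s + H s) := by
  obtain ⟨hF0, μ, hμ⟩ := hF
  obtain ⟨hH0, ν, hν⟩ := hH
  refine ⟨fun s => add_nonneg (hF0 s) (hH0 s), μ + ν, fun s => ?_⟩
  rw [lintegral_add_measure, hμ, hν, ENNReal.ofReal_add (hF0 s) (hH0 s)]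

/-- Products of transforms come from convolutions of measures. -/
theorem mul (hF : IsLaplaceTransform F) (hH : IsLaplaceTransform H) :
    IsLaplaceTransform (fun s => F s * H s) := by
  obtain ⟨hF0, μ, hμ⟩ := hF
  obtain ⟨hH0, ν, hν⟩ := hH
  have := isFiniteMeasure_of_laplace hμ
  have := isFiniteMeasure_of_laplace hν
  refine ⟨fun s => mul_nonneg (hF0 s) (hH0 s), μ.conv ν, fun s => ?_⟩
  have key : ∀ x y : ι → ℝ≥0, ENNReal.ofReal (Real.exp (-∑ i, (s i : ℝ) * (x + y) i))
      = ENNReal.ofReal (Real.exp (-∑ i, (s i : ℝ) * x i))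
        * ENNReal.ofReal (Real.exp (-∑ i, (s i : ℝ) * y i)) := by
    intro x y
    rw [← ENNReal.ofReal_mul (Real.exp_nonneg _), ← Real.exp_add]
    congr 2
    simp only [Pi.add_apply, NNReal.coe_add, mul_add, Finset.sum_add_distrib]
    ring
  rw [Measure.lintegral_conv (measurable_laplaceKernel s)]
  simp_rw [key]
  have h1 : ∀ x : ι → ℝ≥0, ∫⁻ y, ENNReal.ofReal (Real.exp (-∑ i, (s i : ℝ) * x i))
        * ENNReal.ofReal (Real.exp (-∑ i, (s i : ℝ) * y i)) ∂ν
      = ENNReal.ofReal (Real.exp (-∑ i, (s i : ℝ) * x i)) * ENNReal.ofReal (H s) := by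
    intro x
    rw [lintegral_const_mul _ (measurable_laplaceKernel s), hν]
  simp_rw [h1]
  rw [lintegral_mul_const _ (measurable_laplaceKernel s), hμ, ← ENNReal.ofReal_mul (hF0 s)]

theorem const_mul {c : ℝ} (hc : 0 ≤ c) (hF : IsLaplaceTransform F) :
    IsLaplaceTransform (fun s => c * F s) := (const hc).mul hF

theorem pow (hF : IsLaplaceTransform F) (n : ℕ) : IsLaplaceTransform (fun s => F s ^ n) := by
  induction n with
  | zero => simpa using const (ι := ι) zero_le_one
  | succ n ih => simpa only [pow_succ] using ih.mul hF

theorem sum {κ : Type*} (t : Finset κ) {F : κ → (ι → ℝ≥0) → ℝ}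
    (hF : ∀ j, IsLaplaceTransform (F j)) : IsLaplaceTransform (fun s => ∑ j ∈ t, F j s) := by
  classical
  induction t using Finset.induction_on with
  | empty => simpa using const (ι := ι) le_rfl
  | insert a t ha ih => simpa only [Finset.sum_insert ha] using (hF a).add ih

theorem of_hasSum {F : ℕ → (ι → ℝ≥0) → ℝ} (hF : ∀ j, IsLaplaceTransform (F j))
    (h : ∀ s, HasSum (fun j => F j s) (H s)) : IsLaplaceTransform H := by
  choose hF0 μ hμ using hF
  refine ⟨fun s => (h s).nonneg fun j => hF0 j s, Measure.sum μ, fun s => ?_⟩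
  rw [lintegral_sum_measure, ← (h s).tsum_eq,
    ENNReal.ofReal_tsum_of_nonneg (fun j => hF0 j s) (h s).summable]
  simp_rw [hμ]

theorem le_zero (hF : IsLaplaceTransform F) (s : ι → ℝ≥0) : F s ≤ F 0 := by
  obtain ⟨hF0, μ, hμ⟩ := hF
  rw [← ENNReal.ofReal_le_ofReal_iff (hF0 0), ← hμ, ← hμ]
  refine lintegral_mono fun x => ENNReal.ofReal_le_ofReal ?_
  simpa using laplaceKernel_le_one s x

/-- The logarithmic series has nonnegative coefficients. Composed with the exponential series it
handles real powers of `1 - F` without generalized binomial coefficients. -/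
theorem neg_log_one_sub (hF : IsLaplaceTransform F) (h1 : F 0 < 1) :
    IsLaplaceTransform (fun s => -Real.log (1 - F s)) := by
  refine of_hasSum (F := fun j s => F s ^ (j + 1) / (j + 1)) (fun j => ?_) fun s => ?_
  · refine ((hF.pow (j + 1)).const_mul (c := ((j : ℝ) + 1)⁻¹) (by positivity)).congr fun s => ?_
    rw [div_eq_inv_mul]
  · refine Real.hasSum_pow_div_log_of_abs_lt_one ?_
    rw [abs_of_nonneg (hF.1 s)]
    exact (hF.le_zero s).trans_lt h1

theorem exp_sub_one (hF : IsLaplaceTransform F) :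
    IsLaplaceTransform (fun s => Real.exp (F s) - 1) := by
  refine of_hasSum (F := fun j s => F s ^ (j + 1) / (j + 1).factorial) (fun j => ?_) fun s => ?_
  · refine ((hF.pow (j + 1)).const_mul (c := (((j + 1).factorial : ℕ) : ℝ)⁻¹)
      (by positivity)).congr fun s => ?_
    rw [div_eq_inv_mul]
  · have := NormedSpace.expSeries_div_hasSum_exp (F s)
    rw [← Real.exp_eq_exp_ℝ, ← hasSum_nat_add_iff' 1] at this
    simpa using this

/-- The expansion of `(1 - F) ^ (-α)` has nonnegative terms. -/
theorem one_sub_rpow_neg_sub_one (hF : IsLaplaceTransform F) (h1 : F 0 < 1) {α : ℝ}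
    (hα : 0 ≤ α) : IsLaplaceTransform (fun s => (1 - F s) ^ (-α) - 1) := by
  refine (((hF.neg_log_one_sub h1).const_mul hα).exp_sub_one).congr fun s => ?_
  have : 0 < 1 - F s := by linarith [hF.le_zero s]
  rw [Real.rpow_def_of_pos this]
  ring_nf

theorem inv_one_sub (hF : IsLaplaceTransform F) (h1 : F 0 < 1) :
    IsLaplaceTransform (fun s => (1 - F s)⁻¹) := by
  refine ((hF.one_sub_rpow_neg_sub_one h1 zero_le_one).add (const zero_le_one)).congr fun s => ?_
  rw [sub_add_cancel, Real.rpow_neg_one]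

/-- The representing measure is the law of `r` times a standard exponential variable, placed on the
`i`-th axis. -/
theorem inv_one_add_mul {r : ℝ} (hr : 0 ≤ r) (i : ι) :
    IsLaplaceTransform (fun s : ι → ℝ≥0 => (1 + r * s i)⁻¹) := by
  classical
  refine ⟨fun s => by positivity, Measure.map (fun t : ℝ => Pi.single i (Real.toNNReal (r * t)))
    ((volume.restrict (Set.Ioi 0)).withDensity fun t => ENNReal.ofReal (Real.exp (-t))),
    fun s => ?_⟩
  have hm : Measurable fun t : ℝ => (Pi.single i (Real.toNNReal (r * t)) : ι → ℝ≥0) := by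
    refine measurable_pi_iff.2 fun j => ?_
    by_cases hj : j = i
    · subst hj; simp only [Pi.single_eq_same]; fun_prop
    · simp only [Pi.single_eq_of_ne hj]; fun_prop
  rw [lintegral_map (measurable_laplaceKernel s) hm,
    lintegral_withDensity_eq_lintegral_mul _ (by fun_prop)
      (show Measurable fun t : ℝ => ENNReal.ofReal (Real.exp (-∑ j, (s j : ℝ) *
        (Pi.single i (Real.toNNReal (r * t)) : ι → ℝ≥0) j)) from
        (measurable_laplaceKernel s).comp hm)]
  have hpos : 0 < 1 + r * (s i : ℝ) := by positivity
  have h2 : ∫⁻ t in Set.Ioi (0 : ℝ), ENNReal.ofReal (Real.exp (-(1 + r * s i) * t))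
      = ENNReal.ofReal ((1 + r * s i)⁻¹) := by
    have hint := integrableOn_exp_mul_Ioi (a := -(1 + r * (s i : ℝ))) (by linarith) 0
    rw [← ofReal_integral_eq_lintegral_ofReal hint (ae_of_all _ fun t => Real.exp_nonneg _),
      integral_exp_mul_Ioi (by linarith)]
    rw [mul_zero, Real.exp_zero, neg_div_neg_eq, one_div]
  rw [← h2]
  refine setLIntegral_congr_fun measurableSet_Ioi fun t ht => ?_
  have ht : (0 : ℝ) < t := ht
  simp only [Pi.mul_apply]
  rw [← ENNReal.ofReal_mul (Real.exp_nonneg _), ← Real.exp_add]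
  congr 2
  rw [Finset.sum_eq_single i (fun j _ hj => by simp [Pi.single_eq_of_ne hj]) (by simp)]
  rw [Pi.single_eq_same, Real.coe_toNNReal _ (by positivity)]
  ring

end IsLaplaceTransform

/-- A finite measure on the orthant is determined by its Laplace transform. -/
theorem ext_of_laplace {μ ν : Measure (ι → ℝ≥0)} [IsFiniteMeasure μ] [IsFiniteMeasure ν]
    (h : ∀ s : ι → ℝ≥0, ∫⁻ x, ENNReal.ofReal (Real.exp (-∑ i, (s i : ℝ) * x i)) ∂μ
      = ∫⁻ x, ENNReal.ofReal (Real.exp (-∑ i, (s i : ℝ) * x i)) ∂ν) : μ = ν := by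
  let e : (ι → ℝ≥0) → BoundedContinuousFunction (ι → ℝ≥0) ℝ := fun s =>
    BoundedContinuousFunction.ofNormedAddCommGroup
      (fun x => Real.exp (-∑ i, (s i : ℝ) * x i)) (by fun_prop) 1 fun x => by
        rw [Real.norm_of_nonneg (Real.exp_nonneg _)]
        exact laplaceKernel_le_one s x
  have he : ∀ s x, e s x = Real.exp (-∑ i, (s i : ℝ) * x i) := fun s x => rfl
  have hmul : ∀ s t, e s * e t = e (s + t) := by
    intro s t
    ext x
    simp only [BoundedContinuousFunction.mul_apply, he, ← Real.exp_add, Pi.add_apply,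
      NNReal.coe_add, add_mul, Finset.sum_add_distrib]
    ring_nf
  have hone : e 0 = 1 := by ext x; simp [he]
  -- Exponentials are closed under multiplication, so the algebra they generate is just their linear
  -- span. It separates points, and on it integrals are determined by the Laplace transform.
  let M : Submonoid (BoundedContinuousFunction (ι → ℝ≥0) ℝ) :=
    { carrier := Set.range e
      mul_mem' := by
        rintro _ _ ⟨s, rfl⟩ ⟨t, rfl⟩
        exact ⟨s + t, (hmul s t).symm⟩
      one_mem' := ⟨0, hone⟩ }
  let A : StarSubalgebra ℝ (BoundedContinuousFunction (ι → ℝ≥0) ℝ) :=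
    { Algebra.adjoin ℝ (M : Set (BoundedContinuousFunction (ι → ℝ≥0) ℝ)) with
      star_mem' := by
        intro a ha
        rwa [show star a = a by ext x; simp] }
  refine ext_of_forall_mem_subalgebra_integral_eq_of_polish (𝕜 := ℝ) (A := A) ?_ ?_
  · intro x y hxy
    obtain ⟨i, hi⟩ : ∃ i, x i ≠ y i := by
      by_contra hcon
      exact hxy (funext fun i => by_contra fun hne => hcon ⟨i, hne⟩)
    classical
    refine ⟨_, ⟨_, ⟨e (Pi.single i 1), Algebra.subset_adjoin ⟨_, rfl⟩, rfl⟩, rfl⟩, ?_⟩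
    have hsum : ∀ z : ι → ℝ≥0, e (Pi.single i 1) z = Real.exp (-(z i : ℝ)) := by
      intro z
      rw [he, Finset.sum_eq_single i (fun j _ hj => by simp [Pi.single_eq_of_ne hj]) (by simp)]
      simp
    change e (Pi.single i 1) x ≠ e (Pi.single i 1) y
    rw [hsum, hsum]
    intro hcon
    exact hi (NNReal.coe_injective (neg_injective (Real.exp_injective hcon)))
  · intro g hg
    have hg' : g ∈ Submodule.span ℝ (M : Set (BoundedContinuousFunction (ι → ℝ≥0) ℝ)) := by
      have : g ∈ Algebra.adjoin ℝ (M : Set (BoundedContinuousFunction (ι → ℝ≥0) ℝ)) := hg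
      rw [← Subalgebra.mem_toSubmodule, Algebra.adjoin_eq_span, Submonoid.closure_eq] at this
      exact this
    clear hg
    induction hg' using Submodule.span_induction with
    | mem g hg =>
      obtain ⟨s, rfl⟩ := hg
      simp only [he]
      rw [integral_eq_lintegral_of_nonneg_ae (ae_of_all _ fun x => Real.exp_nonneg _)
          (e s).continuous.aestronglyMeasurable,
        integral_eq_lintegral_of_nonneg_ae (ae_of_all _ fun x => Real.exp_nonneg _)
          (e s).continuous.aestronglyMeasurable, h s]
    | zero => simp
    | add f g _ _ hf hg =>
      simp only [BoundedContinuousFunction.coe_add, Pi.add_apply]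
      rw [integral_add (f.integrable μ) (g.integrable μ),
        integral_add (f.integrable ν) (g.integrable ν), hf, hg]
    | smul c f _ hf =>
      simp only [BoundedContinuousFunction.coe_smul, integral_smul, hf]

end LaplaceTransform

/-! ### The determinant and the decomposition of its negative powers -/

/-- The determinant of a rank two perturbation of a diagonal matrix. -/
theorem det_one_add_rank_two_mul_diagonal {ι : Type*} [Fintype ι] [DecidableEq ι]
    (l F H s : ι → ℝ) (h : ∀ i, 1 + l i * s i ≠ 0) :
    (1 + (Matrix.of fun i j => (if i = j then l i else 0) + 1 + F i * H j)
        * Matrix.diagonal s).det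
      = (∏ i, (1 + l i * s i)) *
        ((1 + ∑ i, s i / (1 + l i * s i)) * (1 + ∑ i, s i / (1 + l i * s i) * (F i * H i))
          - (∑ i, s i / (1 + l i * s i) * F i) * ∑ i, s i / (1 + l i * s i) * H i) := by
  -- Once the diagonal factor is pulled out, what remains is `1 + A * B` with inner dimension two,
  -- and `det (1 + A * B) = det (1 + B * A)` is a two by two determinant.
  let A : Matrix ι (Fin 2) ℝ := Matrix.of fun i =>
    ![(1 + l i * s i)⁻¹, (1 + l i * s i)⁻¹ * F i]
  let B : Matrix (Fin 2) ι ℝ := Matrix.of ![fun j => s j, fun j => H j * s j]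
  have h1 : (1 + (Matrix.of fun i j => (if i = j then l i else 0) + 1 + F i * H j)
        * Matrix.diagonal s) = Matrix.diagonal (fun i => 1 + l i * s i) * (1 + A * B) := by
    ext i j
    have hi := h i
    rw [Matrix.diagonal_mul, Matrix.add_apply, Matrix.add_apply, Matrix.mul_diagonal,
      Matrix.mul_apply, Fin.sum_univ_two, Matrix.one_apply]
    simp only [Matrix.of_apply, A, B, Matrix.cons_val_zero, Matrix.cons_val_one]
    by_cases hij : i = j
    · subst hij
      simp only [if_true]
      field_simp
      ring
    · simp only [if_neg hij]
      field_simp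
      ring
  rw [h1, Matrix.det_mul, Matrix.det_diagonal, Matrix.det_one_add_mul_comm, Matrix.det_fin_two]
  congr 1
  simp only [Matrix.add_apply, Matrix.one_apply, Matrix.mul_apply, A, B, Matrix.of_apply,
    Matrix.cons_val_zero, Matrix.cons_val_one]
  have e1 : ∑ i, s i * (1 + l i * s i)⁻¹ = ∑ i, s i / (1 + l i * s i) := by
    simp only [div_eq_mul_inv]
  have e2 : ∑ i, H i * s i * ((1 + l i * s i)⁻¹ * F i)
      = ∑ i, s i / (1 + l i * s i) * (F i * H i) :=
    Finset.sum_congr rfl fun i _ => by rw [div_eq_mul_inv]; ring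
  have e3 : ∑ i, s i * ((1 + l i * s i)⁻¹ * F i) = ∑ i, s i / (1 + l i * s i) * F i :=
    Finset.sum_congr rfl fun i _ => by rw [div_eq_mul_inv]; ring
  have e4 : ∑ i, H i * s i * (1 + l i * s i)⁻¹ = ∑ i, s i / (1 + l i * s i) * H i :=
    Finset.sum_congr rfl fun i _ => by rw [div_eq_mul_inv]; ring
  rw [e1, e2, e3, e4]
  norm_num

/-- The rate of the gamma variable in the minorant of the law of the permanental process. -/
noncomputable def minorantRate (p q r : ℝ) : ℝ :=
  1 - (1 + q) / (2 + r) + (1 + p) / (2 + r) * (q - (1 + q) / (2 + r) * r)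

/-- The factor by which the gamma variable is shrunk in the minorant of the law of the
permanental process. -/
noncomputable def minorantFactor (p q r φ γ : ℝ) : ℝ :=
  (1 - (1 + p) / (2 + r) * γ) * (1 - (1 + q) / (2 + r) * φ)

/-- The first part `1 - b`, with `b = (1 + q) / (2 + r)`, is already positive because `q < 1`; the
rest is nonnegative because `b r ≤ r ≤ q`. -/
theorem minorantRate_pos {p q r : ℝ} (hp : 0 ≤ p) (hq1 : q < 1) (hr : 0 ≤ r)
    (hrq : r ≤ q) : 0 < minorantRate p q r := by
  have hb : (1 + q) / (2 + r) < 1 := by rw [div_lt_one (by linarith)]; linarith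
  have hb0 : 0 ≤ (1 + q) / (2 + r) := by apply div_nonneg <;> linarith
  have ha0 : 0 ≤ (1 + p) / (2 + r) := by apply div_nonneg <;> linarith
  have : 0 ≤ q - (1 + q) / (2 + r) * r := by nlinarith
  unfold minorantRate
  nlinarith [mul_nonneg ha0 this]

theorem minorantFactor_nonneg {p q r φ γ : ℝ} (hp : 0 ≤ p) (hp1 : p < 1) (hq : 0 ≤ q)
    (hq1 : q < 1) (hr : 0 ≤ r) (hφ : φ ≤ 1) (hγ : γ ≤ 1) :
    0 ≤ minorantFactor p q r φ γ := by
  have hb : (1 + q) / (2 + r) < 1 := by rw [div_lt_one (by linarith)]; linarith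
  have hb0 : 0 ≤ (1 + q) / (2 + r) := by apply div_nonneg <;> linarith
  have ha : (1 + p) / (2 + r) < 1 := by rw [div_lt_one (by linarith)]; linarith
  have ha0 : 0 ≤ (1 + p) / (2 + r) := by apply div_nonneg <;> linarith
  exact mul_nonneg (by nlinarith) (by nlinarith)

/-- The Laplace transform of a vector `(Y, X_1, …, X_M)`, where `Y` is gamma distributed with
shape `α` and rate `c` and, given `Y`, the `X_j` are independent noncentral chi-square. -/
noncomputable def minorantLaplace {M : ℕ} (α c : ℝ) (lam e : Fin M → ℝ)
    (s : Fin (M + 1) → ℝ≥0) : ℝ :=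
  (∏ j, (1 + lam j * s j.succ)⁻¹ ^ α) *
    (c / (c + s 0 + ∑ j, e j * (s j.succ / (1 + lam j * s j.succ)))) ^ α

/-- Write `τ = 2 + r - L` for the factor `2 + ∑ w_j φ_j γ_j`. With `a = (1 + p) / (2 + r)` and `b =
(1 + q) / (2 + r)` one has `1 + ∑ w_j φ_j = a τ - P'` and `1 + ∑ w_j γ_j = b τ - Q'`. Dividing the
bracket by `τ` then leaves `D - P' Q' / τ`, where `D` is affine in `s_0` and the `w_j`: every
nonlinear term sits in `P' Q' / τ`. Since `a, b < 1`, the forms `L`, `P'`, `Q'` still have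
nonnegative coefficients in the `y_j`. The three hypotheses on `r` say that the constant terms,
which carry the part of the series beyond the window, are nonnegative as well. -/
theorem laplace_decomposition {M : ℕ} {α : ℝ} (hα : 0 < α) {lam φ γ : Fin M → ℝ} {p q r : ℝ}
    (hlam : ∀ j, 0 < lam j) (hφ : ∀ j, 0 ≤ φ j ∧ φ j ≤ 1) (hγ : ∀ j, 0 ≤ γ j ∧ γ j ≤ 1)
    (hp1 : p < 1) (hq1 : q < 1)
    (hr : ∑ j, φ j * γ j / lam j ≤ r)
    (hrp : r - ∑ j, φ j * γ j / lam j ≤ p - ∑ j, φ j / lam j)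
    (hrq : r - ∑ j, φ j * γ j / lam j ≤ q - ∑ j, γ j / lam j)
    (hmin : IsLaplaceTransform (minorantLaplace α (minorantRate p q r) lam
      fun j => minorantFactor p q r (φ j) (γ j))) :
    ∃ V : (Fin (M + 1) → ℝ≥0) → ℝ, IsLaplaceTransform V ∧ ∀ s : Fin (M + 1) → ℝ≥0,
      1 / ((∏ j, (1 + lam j * s j.succ)) *
        ((1 + s 0 + ∑ j, s j.succ / (1 + lam j * s j.succ)) *
            (2 + ∑ j, s j.succ / (1 + lam j * s j.succ) * (φ j * γ j))
          - (1 + ∑ j, s j.succ / (1 + lam j * s j.succ) * φ j) *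
            (1 + ∑ j, s j.succ / (1 + lam j * s j.succ) * γ j))) ^ α
      = ((2 + r) * minorantRate p q r) ^ (-α) *
          minorantLaplace α (minorantRate p q r) lam
            (fun j => minorantFactor p q r (φ j) (γ j)) s + V s := by
  have hS0 : 0 ≤ ∑ j, φ j * γ j / lam j := Finset.sum_nonneg fun j _ =>
    div_nonneg (mul_nonneg (hφ j).1 (hγ j).1) (hlam j).le
  have hSp : 0 ≤ ∑ j, φ j / lam j := Finset.sum_nonneg fun j _ =>
    div_nonneg (hφ j).1 (hlam j).le
  have hSq : ∑ j, φ j * γ j / lam j ≤ ∑ j, γ j / lam j := Finset.sum_le_sum fun j _ =>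
    div_le_div_of_nonneg_right (mul_le_of_le_one_left (hγ j).1 (hφ j).2) (hlam j).le
  have hr0 : 0 ≤ r := hS0.trans hr
  have hp0 : 0 ≤ p := by linarith
  have hq0 : 0 ≤ q := by linarith
  have hrq' : r ≤ q := by linarith
  have hC'0 := minorantRate_pos hp0 hq1 hr0 hrq'
  have hτ0 : 0 < 2 + r := by linarith
  set a := (1 + p) / (2 + r) with ha_def
  set b := (1 + q) / (2 + r) with hb_def
  have hb : b < 1 := by rw [hb_def, div_lt_one (by linarith)]; linarith
  have hb0 : 0 ≤ b := by apply div_nonneg <;> linarith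
  have ha : a < 1 := by rw [ha_def, div_lt_one (by linarith)]; linarith
  have ha0 : 0 ≤ a := by apply div_nonneg <;> linarith
  set c := minorantRate p q r with hc_def
  have hc_eq : c = 1 - b + a * (q - b * r) := rfl
  set e : Fin M → ℝ := fun j => minorantFactor p q r (φ j) (γ j) with he_def
  have he0 : ∀ j, 0 ≤ e j := fun j =>
    minorantFactor_nonneg hp0 hp1 hq0 hq1 hr0 (hφ j).2 (hγ j).2
  have he_eq : ∀ j, e j = 1 - a * γ j - b * φ j + a * b * (φ j * γ j) := fun j => by
    rw [he_def]; simp only [minorantFactor]; ring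
  let y : Fin M → (Fin (M + 1) → ℝ≥0) → ℝ := fun j s => (1 + lam j * s j.succ)⁻¹
  have hy : ∀ j, IsLaplaceTransform (y j) := fun j =>
    IsLaplaceTransform.inv_one_add_mul (hlam j).le j.succ
  have hy0 : ∀ j, y j 0 = 1 := fun j => by simp [y]
  have hw : ∀ (s : Fin (M + 1) → ℝ≥0) j, (s j.succ : ℝ) / (1 + lam j * s j.succ)
      = (1 - y j s) / lam j := by
    intro s j
    have h1 := hlam j
    have h2 : 0 < 1 + lam j * s j.succ := by positivity
    simp only [y]
    field_simp
    ring
  -- linear forms in the `y j` with nonnegative coefficients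
  have hlin : ∀ (k : ℝ) (u : Fin M → ℝ), 0 ≤ k → (∀ j, 0 ≤ u j) →
      IsLaplaceTransform (fun s => k + ∑ j, u j / lam j * y j s) := fun k u hk hu =>
    (IsLaplaceTransform.const hk).add (IsLaplaceTransform.sum _ fun j =>
      (hy j).const_mul (div_nonneg (hu j) (hlam j).le))
  let L : (Fin (M + 1) → ℝ≥0) → ℝ := fun s =>
    (r - ∑ j, φ j * γ j / lam j) + ∑ j, φ j * γ j / lam j * y j s
  let P' : (Fin (M + 1) → ℝ≥0) → ℝ := fun s =>
    ((p - ∑ j, φ j / lam j) - a * (r - ∑ j, φ j * γ j / lam j))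
      + ∑ j, φ j * (1 - a * γ j) / lam j * y j s
  let Q' : (Fin (M + 1) → ℝ≥0) → ℝ := fun s =>
    ((q - ∑ j, γ j / lam j) - b * (r - ∑ j, φ j * γ j / lam j))
      + ∑ j, γ j * (1 - b * φ j) / lam j * y j s
  let E : (Fin (M + 1) → ℝ≥0) → ℝ := fun s => 0 + ∑ j, e j / lam j * y j s
  have hL : IsLaplaceTransform L := hlin _ _ (by linarith) fun j =>
    mul_nonneg (hφ j).1 (hγ j).1
  have hP' : IsLaplaceTransform P' := hlin _ _ (by nlinarith) fun j =>
    mul_nonneg (hφ j).1 (by nlinarith [(hγ j).1, (hγ j).2])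
  have hQ' : IsLaplaceTransform Q' := hlin _ _ (by nlinarith) fun j =>
    mul_nonneg (hγ j).1 (by nlinarith [(hφ j).1, (hφ j).2])
  have hE : IsLaplaceTransform E := hlin _ _ le_rfl he0
  have hsum : ∀ (u : Fin M → ℝ) s, ∑ j, u j / lam j * y j s
      = ∑ j, u j / lam j - ∑ j, (s j.succ : ℝ) / (1 + lam j * s j.succ) * u j := by
    intro u s
    rw [← Finset.sum_sub_distrib]
    refine Finset.sum_congr rfl fun j _ => ?_
    rw [hw]
    ring
  -- `D = C + s_0 - E` with `E` a nonnegative form in the `y_j`, so `1 / D` is the geometric series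
  -- `x / (1 - x E)` with `x = 1 / (C + s_0)`.
  set C := c + ∑ j, e j / lam j with hC_def
  have hCc : 0 ≤ ∑ j, e j / lam j := Finset.sum_nonneg fun j _ =>
    div_nonneg (he0 j) (hlam j).le
  have hC0 : 0 < C := by linarith
  let x : (Fin (M + 1) → ℝ≥0) → ℝ := fun s => C⁻¹ * (1 + C⁻¹ * s 0)⁻¹
  have hx : IsLaplaceTransform x :=
    (IsLaplaceTransform.inv_one_add_mul (inv_nonneg.2 hC0.le) 0).const_mul (inv_nonneg.2 hC0.le)
  have hx_eq : ∀ s, x s = (C + s 0)⁻¹ := fun s => by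
    simp only [x]
    rw [← mul_inv]
    congr 1
    field_simp
  -- the three small quantities in the expansion
  let u1 : (Fin (M + 1) → ℝ≥0) → ℝ := fun s => (2 + r)⁻¹ * L s
  have hu1 : IsLaplaceTransform u1 := hL.const_mul (by positivity)
  have hL0 : L 0 = r := by simp [L, hy0]
  have hu10 : u1 0 < 1 := by
    simp only [u1, hL0]
    rw [inv_mul_lt_iff₀ hτ0]; linarith
  let u2 : (Fin (M + 1) → ℝ≥0) → ℝ := fun s => x s * E s
  have hu2 : IsLaplaceTransform u2 := hx.mul hE
  have hu20 : u2 0 = (∑ j, e j / lam j) / C := by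
    simp only [u2, hx_eq, E, hy0]
    simp [div_eq_inv_mul]
  have hu20' : u2 0 < 1 := by
    rw [hu20, div_lt_one hC0]; linarith
  let h : (Fin (M + 1) → ℝ≥0) → ℝ := fun s => x s * (1 - u2 s)⁻¹
  have hh : IsLaplaceTransform h := hx.mul (hu2.inv_one_sub hu20')
  let it : (Fin (M + 1) → ℝ≥0) → ℝ := fun s => (2 + r)⁻¹ * (1 - u1 s)⁻¹
  have hit : IsLaplaceTransform it := (hu1.inv_one_sub hu10).const_mul (by positivity)
  let u3 : (Fin (M + 1) → ℝ≥0) → ℝ := fun s => h s * (P' s * Q' s * it s)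
  have hu3 : IsLaplaceTransform u3 := hh.mul ((hP'.mul hQ').mul hit)
  let D : (Fin (M + 1) → ℝ≥0) → ℝ := fun s =>
    c + s 0 + ∑ j, e j * (s j.succ / (1 + lam j * s j.succ))
  have hD0 : ∀ s, 0 < D s := fun s => by
    have : 0 ≤ ∑ j, e j * ((s j.succ : ℝ) / (1 + lam j * s j.succ)) :=
      Finset.sum_nonneg fun j _ => mul_nonneg (he0 j) (by have := hlam j; positivity)
    have h0 : (0 : ℝ) ≤ s 0 := (s 0).2
    simp only [D]; linarith
  have hh_eq : ∀ s, h s = (D s)⁻¹ := by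
    intro s
    have h1 : 0 < C + s 0 := by positivity
    have h2 : D s = (C + s 0) * (1 - u2 s) := by
      simp only [u2, hx_eq, D, E, hsum]
      simp only [mul_comm (e _)]
      field_simp
      rw [hC_def]
      ring
    rw [h2, mul_inv, ← hx_eq]
  have hit_eq : ∀ s, it s = (2 + r - L s)⁻¹ := by
    intro s
    simp only [it, u1]
    rw [← mul_inv]
    congr 1
    field_simp
  -- At `s = 0` the bracket is `2 - 1 = 1`, while `τ = 2` and `D = c`; hence `u3 0 = 1 - 1 / (2 c)`.
  have hu30 : u3 0 < 1 := by
    have h1 : D 0 = c := by simp [D]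
    have hP0 : P' 0 = p - a * r := by
      simp only [P', hy0]
      have : ∑ j, φ j * (1 - a * γ j) / lam j * 1
          = ∑ j, φ j / lam j - a * ∑ j, φ j * γ j / lam j := by
        rw [Finset.mul_sum, ← Finset.sum_sub_distrib]
        exact Finset.sum_congr rfl fun j _ => by ring
      rw [this]; ring
    have hQ0 : Q' 0 = q - b * r := by
      simp only [Q', hy0]
      have : ∑ j, γ j * (1 - b * φ j) / lam j * 1
          = ∑ j, γ j / lam j - b * ∑ j, φ j * γ j / lam j := by
        rw [Finset.mul_sum, ← Finset.sum_sub_distrib]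
        exact Finset.sum_congr rfl fun j _ => by ring
      rw [this]; ring
    have h2 : (p - a * r) * (q - b * r) = 2 * c - 1 := by
      rw [hc_eq, ha_def, hb_def]
      field_simp
      ring
    simp only [u3, hh_eq, hit_eq, h1, hP0, hQ0, hL0, h2]
    rw [show 2 + r - r = 2 by ring, inv_mul_lt_iff₀ hC'0]
    linarith
  have hv1 := hu1.one_sub_rpow_neg_sub_one hu10 hα.le
  have hv3 := hu3.one_sub_rpow_neg_sub_one hu30 hα.le
  -- With `v = (1 - u) ^ (-α) - 1` for `u = u1, u3`, the two extra factors are `(1 + v1)(1 + v3)`.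
  -- The `1` gives the minorant, and `v1 + v3 + v1 v3` gives the remainder.
  refine ⟨_, (hmin.const_mul (c := ((2 + r) * c) ^ (-α)) (by positivity)).mul
    ((hv1.add hv3).add (hv1.mul hv3)), fun s => ?_⟩
  have h1u1 : 0 < 1 - u1 s := by linarith [hu1.le_zero s]
  have h1u3 : 0 < 1 - u3 s := by linarith [hu3.le_zero s]
  have hDs := hD0 s
  have hprod : 0 < ∏ j, (1 + lam j * (s j.succ : ℝ)) := Finset.prod_pos fun j _ => by
    have := hlam j; positivity
  have hτ : 0 < 2 + r - L s := by
    have : 2 + r - L s = (2 + r) * (1 - u1 s) := by simp only [u1]; field_simp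
    rw [this]; positivity
  have hΦ : (1 + s 0 + ∑ j, (s j.succ : ℝ) / (1 + lam j * s j.succ)) *
            (2 + ∑ j, (s j.succ : ℝ) / (1 + lam j * s j.succ) * (φ j * γ j))
          - (1 + ∑ j, (s j.succ : ℝ) / (1 + lam j * s j.succ) * φ j) *
            (1 + ∑ j, (s j.succ : ℝ) / (1 + lam j * s j.succ) * γ j)
      = (2 + r) * (1 - u1 s) * (D s * (1 - u3 s)) := by
    have e1 : (2 + r) * (1 - u1 s) = 2 + r - L s := by simp only [u1]; field_simp
    have e2 : D s * (1 - u3 s) = D s - P' s * Q' s / (2 + r - L s) := by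
      simp only [u3, hh_eq, hit_eq]
      field_simp
    rw [e1, e2, mul_sub, mul_div_cancel₀ _ hτ.ne']
    have eL : L s = r - ∑ j, (s j.succ : ℝ) / (1 + lam j * s j.succ) * (φ j * γ j) := by
      simp only [L, hsum]; ring
    have eP : P' s = p - ∑ j, (s j.succ : ℝ) / (1 + lam j * s j.succ) * φ j - a * L s := by
      simp only [P', hsum, eL]
      have i1 : ∑ j, φ j * (1 - a * γ j) / lam j
          = ∑ j, φ j / lam j - a * ∑ j, φ j * γ j / lam j := by
        rw [Finset.mul_sum, ← Finset.sum_sub_distrib]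
        exact Finset.sum_congr rfl fun j _ => by ring
      have i2 : ∑ j, (s j.succ : ℝ) / (1 + lam j * s j.succ) * (φ j * (1 - a * γ j))
          = ∑ j, (s j.succ : ℝ) / (1 + lam j * s j.succ) * φ j
            - a * ∑ j, (s j.succ : ℝ) / (1 + lam j * s j.succ) * (φ j * γ j) := by
        rw [Finset.mul_sum, ← Finset.sum_sub_distrib]
        exact Finset.sum_congr rfl fun j _ => by ring
      rw [i1, i2]; ring
    have eQ : Q' s = q - ∑ j, (s j.succ : ℝ) / (1 + lam j * s j.succ) * γ j - b * L s := by
      simp only [Q', hsum, eL]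
      have i1 : ∑ j, γ j * (1 - b * φ j) / lam j
          = ∑ j, γ j / lam j - b * ∑ j, φ j * γ j / lam j := by
        rw [Finset.mul_sum, ← Finset.sum_sub_distrib]
        exact Finset.sum_congr rfl fun j _ => by ring
      have i2 : ∑ j, (s j.succ : ℝ) / (1 + lam j * s j.succ) * (γ j * (1 - b * φ j))
          = ∑ j, (s j.succ : ℝ) / (1 + lam j * s j.succ) * γ j
            - b * ∑ j, (s j.succ : ℝ) / (1 + lam j * s j.succ) * (φ j * γ j) := by
        rw [Finset.mul_sum, ← Finset.sum_sub_distrib]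
        exact Finset.sum_congr rfl fun j _ => by ring
      rw [i1, i2]; ring
    have eD : D s = c + s 0 + ∑ j, (s j.succ : ℝ) / (1 + lam j * s j.succ)
        - a * ∑ j, (s j.succ : ℝ) / (1 + lam j * s j.succ) * γ j
        - b * ∑ j, (s j.succ : ℝ) / (1 + lam j * s j.succ) * φ j
        + a * b * ∑ j, (s j.succ : ℝ) / (1 + lam j * s j.succ) * (φ j * γ j) := by
      have : ∑ j, e j * ((s j.succ : ℝ) / (1 + lam j * s j.succ))
          = ∑ j, (s j.succ : ℝ) / (1 + lam j * s j.succ)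
            - a * ∑ j, (s j.succ : ℝ) / (1 + lam j * s j.succ) * γ j
            - b * ∑ j, (s j.succ : ℝ) / (1 + lam j * s j.succ) * φ j
            + a * b * ∑ j, (s j.succ : ℝ) / (1 + lam j * s j.succ) * (φ j * γ j) := by
        rw [Finset.mul_sum, Finset.mul_sum, Finset.mul_sum, ← Finset.sum_sub_distrib,
          ← Finset.sum_sub_distrib, ← Finset.sum_add_distrib]
        exact Finset.sum_congr rfl fun j _ => by rw [he_eq]; ring
      simp only [D]
      rw [this]; ring
    rw [eP, eQ, eD, eL, hc_eq, ha_def, hb_def]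
    generalize ∑ j, (s j.succ : ℝ) / (1 + lam j * s j.succ) * (φ j * γ j) = S1
    generalize ∑ j, (s j.succ : ℝ) / (1 + lam j * s j.succ) * γ j = S2
    generalize ∑ j, (s j.succ : ℝ) / (1 + lam j * s j.succ) * φ j = S3
    generalize ∑ j, (s j.succ : ℝ) / (1 + lam j * s j.succ) = S4
    field_simp
    ring
  rw [hΦ, Real.mul_rpow hprod.le (by positivity), Real.mul_rpow (by positivity) (by positivity),
    Real.mul_rpow hτ0.le h1u1.le, Real.mul_rpow hDs.le h1u3.le]
  have hyprod : ∏ j, (1 + lam j * (s j.succ : ℝ))⁻¹ ^ α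
      = ((∏ j, (1 + lam j * (s j.succ : ℝ))) ^ α)⁻¹ := by
    rw [← Real.finsetProd_rpow _ _ fun j _ => by have := hlam j; positivity,
      ← Finset.prod_inv_distrib]
    exact Finset.prod_congr rfl fun j _ => Real.inv_rpow (by have := hlam j; positivity) _
  simp only [minorantLaplace]
  rw [hyprod, show c + (s 0 : ℝ) + ∑ j, e j * (s j.succ / (1 + lam j * s j.succ)) = D s from rfl,
    Real.div_rpow hC'0.le hDs.le, Real.mul_rpow hτ0.le hC'0.le, Real.rpow_neg hτ0.le,
    Real.rpow_neg hC'0.le, Real.rpow_neg h1u1.le, Real.rpow_neg h1u3.le]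
  have := Real.rpow_pos_of_pos hC'0 α
  have := Real.rpow_pos_of_pos hDs α
  have := Real.rpow_pos_of_pos h1u1 α
  have := Real.rpow_pos_of_pos h1u3 α
  have := Real.rpow_pos_of_pos hτ0 α
  have := Real.rpow_pos_of_pos hprod α
  field_simp
  ring

/-! ### The gamma mixture of noncentral chi-square variables -/

/-- The Laplace transform of a noncentral chi-square variable with one degree of freedom. -/
theorem lintegral_exp_neg_sq_gaussianReal {l s : ℝ} (hl : 0 ≤ l) (hs : 0 ≤ s) (c : ℝ) :
    ∫⁻ x, ENNReal.ofReal (Real.exp (-(s * ((√l * x + c) ^ 2 / 2)))) ∂gaussianReal 0 1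
      = ENNReal.ofReal ((1 + l * s)⁻¹ ^ (1 / 2 : ℝ) *
          Real.exp (-(s / (1 + l * s) * (c ^ 2 / 2)))) := by
  have hpos : 0 < 1 + l * s := by positivity
  let v : ℝ≥0 := ⟨(1 + l * s)⁻¹, by positivity⟩
  have hv : v ≠ 0 := by
    intro h
    have : (v : ℝ) = 0 := by rw [h]; rfl
    exact (inv_pos.2 hpos).ne' this
  have hv' : (v : ℝ) = (1 + l * s)⁻¹ := rfl
  set K := (1 + l * s)⁻¹ ^ (1 / 2 : ℝ) * Real.exp (-(s / (1 + l * s) * (c ^ 2 / 2))) with hK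
  have hK0 : 0 ≤ K := by positivity
  rw [gaussianReal_of_var_ne_zero 0 one_ne_zero,
    lintegral_withDensity_eq_lintegral_mul _ (measurable_gaussianPDF 0 1) (by fun_prop)]
  -- Completing the square turns the integrand into a constant times a normal density of variance `1
  -- / (1 + l s)`.
  have key : ∀ x, (gaussianPDF 0 1 * fun x =>
      ENNReal.ofReal (Real.exp (-(s * ((√l * x + c) ^ 2 / 2))))) x
      = ENNReal.ofReal K * gaussianPDF (-(s * √l * c) / (1 + l * s)) v x := by
    intro x
    simp only [Pi.mul_apply, gaussianPDF]
    rw [← ENNReal.ofReal_mul (gaussianPDFReal_nonneg _ _ _), ← ENNReal.ofReal_mul hK0]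
    congr 1
    simp only [gaussianPDFReal, hK, hv', NNReal.coe_one, mul_one]
    have h1 : √(2 * Real.pi * (1 + l * s)⁻¹) = √(2 * Real.pi) * (1 + l * s)⁻¹ ^ (1 / 2 : ℝ) := by
      rw [Real.sqrt_mul (by positivity), ← Real.sqrt_eq_rpow]
    have h2 : (0 : ℝ) < (1 + l * s)⁻¹ ^ (1 / 2 : ℝ) := by positivity
    rw [h1, mul_inv, mul_assoc, ← Real.exp_add]
    have h3 : -(x - 0) ^ 2 / 2 + -(s * ((√l * x + c) ^ 2 / 2))
        = -(s / (1 + l * s) * (c ^ 2 / 2))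
          + -(x - -(s * √l * c) / (1 + l * s)) ^ 2 / (2 * (1 + l * s)⁻¹) := by
      have h4 : l = √l ^ 2 := (Real.sq_sqrt hl).symm
      generalize √l = t at h4 ⊢
      subst h4
      field_simp
      ring
    rw [h3, Real.exp_add]
    field_simp
  rw [lintegral_congr key, lintegral_const_mul _ (measurable_gaussianPDF _ _),
    lintegral_gaussianPDF_eq_one _ hv, mul_one]

theorem measurable_gammaPDF (α c : ℝ) : Measurable (gammaPDF α c) :=
  (measurable_gammaPDFReal α c).ennreal_ofReal

theorem lintegral_exp_neg_gammaMeasure {α c t : ℝ} (hα : 0 < α) (hc : 0 < c) (ht : 0 ≤ t) :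
    ∫⁻ x, ENNReal.ofReal (Real.exp (-(t * x))) ∂gammaMeasure α c
      = ENNReal.ofReal ((c / (c + t)) ^ α) := by
  have hct : 0 < c + t := by positivity
  rw [gammaMeasure, lintegral_withDensity_eq_lintegral_mul _
    (measurable_gammaPDF α c) (by fun_prop)]
  have key : ∀ x, (gammaPDF α c * fun x => ENNReal.ofReal (Real.exp (-(t * x)))) x
      = ENNReal.ofReal ((c / (c + t)) ^ α) * gammaPDF α (c + t) x := by
    intro x
    simp only [Pi.mul_apply, gammaPDF]
    rw [← ENNReal.ofReal_mul' (Real.exp_nonneg _), ← ENNReal.ofReal_mul (by positivity)]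
    congr 1
    simp only [gammaPDFReal]
    split_ifs with hx
    · rw [Real.div_rpow hc.le hct.le, mul_assoc, ← Real.exp_add]
      have := Real.rpow_pos_of_pos hct α
      have := Real.Gamma_pos_of_pos hα
      rw [show -(c * x) + -(t * x) = -((c + t) * x) by ring]
      field_simp
    · simp
  rw [lintegral_congr key, lintegral_const_mul _ (measurable_gammaPDF _ _),
    lintegral_gammaPDF_eq_one hα hct, mul_one]

theorem ae_nonneg_gammaMeasure (α c : ℝ) : ∀ᵐ x ∂gammaMeasure α c, 0 ≤ x := by
  rw [gammaMeasure, ae_withDensity_iff (measurable_gammaPDF α c)]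
  refine ae_of_all _ fun x hx => ?_
  by_contra hneg
  exact hx (gammaPDF_of_neg (not_le.1 hneg))

/-- The probability measure carrying a gamma variable with shape `α` and rate `c` and an
independent array of independent standard normal variables. -/
noncomputable def gammaGaussianMeasure (α c : ℝ) : Measure (ℝ × (ℕ × ℕ → ℝ)) :=
  (gammaMeasure α c).prod (Measure.infinitePi fun _ => gaussianReal 0 1)

/-- A scaled noncentral chi-square variable with `d + 1` degrees of freedom and
noncentrality `y`, as a function of normal variables. -/
noncomputable def chiSquare (d : ℕ) (l y : ℝ) (z : ℕ → ℝ) : ℝ :=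
  ∑ i : Fin (d + 1), (√l * z i + if i = 0 then √(2 * y) else 0) ^ 2 / 2

theorem chiSquare_nonneg (d : ℕ) (l y : ℝ) (z : ℕ → ℝ) : 0 ≤ chiSquare d l y z :=
  Finset.sum_nonneg fun _ _ => by positivity

theorem measurable_chiSquare (d : ℕ) (l e : ℝ) (j : ℕ) :
    Measurable fun ω : ℝ × (ℕ × ℕ → ℝ) => chiSquare d l (e * ω.1) fun i => ω.2 (j, i) := by
  unfold chiSquare
  refine Finset.measurable_fun_sum _ fun i _ => ?_
  split_ifs <;> fun_prop

/-- The first `M + 1` coordinates, starting from the index `n`, of the minorant process. -/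
noncomputable def minorantVector (d : ℕ) (lam e : ℕ → ℝ) (n M : ℕ) (ω : ℝ × (ℕ × ℕ → ℝ)) :
    Fin (M + 1) → ℝ≥0 :=
  Fin.cons ω.1.toNNReal fun j : Fin M =>
    (chiSquare d (lam (n + j)) (e (n + j) * ω.1) fun i => ω.2 (n + j, i)).toNNReal

theorem measurable_minorantVector (d : ℕ) (lam e : ℕ → ℝ) (n M : ℕ) :
    Measurable (minorantVector d lam e n M) := by
  refine measurable_pi_iff.2 fun i => ?_
  refine Fin.cases ?_ (fun j => ?_) i
  · simp only [minorantVector, Fin.cons_zero]; fun_prop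
  · simp only [minorantVector, Fin.cons_succ]
    exact (measurable_chiSquare d _ _ _).real_toNNReal

/-- Independence factors the integral over all pairs `(j, i)`. Each of the `d + 1` normals
contributes a power `1 / 2`, and only `i = 0` carries the noncentrality, hence a single exponential
factor. -/
theorem lintegral_exp_neg_chiSquare (d : ℕ) {M n : ℕ} {l v s : Fin M → ℝ}
    (hl : ∀ j, 0 ≤ l j) (hv : ∀ j, 0 ≤ v j) (hs : ∀ j, 0 ≤ s j) :
    ∫⁻ z, ENNReal.ofReal (Real.exp (-∑ j : Fin M, s j *
        chiSquare d (l j) (v j) fun i => z (n + j, i)))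
        ∂(Measure.infinitePi fun _ : ℕ × ℕ => gaussianReal 0 1)
      = ENNReal.ofReal (∏ j, ((1 + l j * s j)⁻¹ ^ (((d + 1 : ℕ) : ℝ) / 2) *
          Real.exp (-(s j / (1 + l j * s j) * v j)))) := by
  let F : Fin M × Fin (d + 1) → ℝ → ℝ≥0∞ := fun a x => ENNReal.ofReal (Real.exp
    (-(s a.1 * ((√(l a.1) * x + if a.2 = 0 then √(2 * v a.1) else 0) ^ 2 / 2))))
  have hF : ∀ a, Measurable (F a) := fun a => by
    simp only [F]; fun_prop
  let σ : Fin M × Fin (d + 1) → ℕ × ℕ := fun a => (n + a.1, a.2)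
  have hσ : Function.Injective σ := by
    rintro ⟨a, b⟩ ⟨a', b'⟩ hab
    simp only [σ, Prod.mk.injEq, add_right_inj, Fin.val_inj] at hab
    exact Prod.ext hab.1 hab.2
  have hind : iIndepFun (fun (a : Fin M × Fin (d + 1)) (z : ℕ × ℕ → ℝ) => F a (z (σ a)))
      (Measure.infinitePi fun _ : ℕ × ℕ => gaussianReal 0 1) := by
    have h0 : iIndepFun (fun (i : ℕ × ℕ) (z : ℕ × ℕ → ℝ) => z i)
        (Measure.infinitePi fun _ : ℕ × ℕ => gaussianReal 0 1) :=
      iIndepFun_infinitePi (X := fun _ x => x) fun _ => measurable_id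
    exact (h0.precomp hσ).comp F hF
  have h1 : ∀ z : ℕ × ℕ → ℝ, ENNReal.ofReal (Real.exp (-∑ j : Fin M, s j *
        chiSquare d (l j) (v j) fun i => z (n + j, i))) = ∏ a, F a (z (σ a)) := by
    intro z
    simp only [F]
    rw [← ENNReal.ofReal_prod_of_nonneg fun _ _ => Real.exp_nonneg _, ← Real.exp_sum,
      Finset.sum_neg_distrib, Fintype.sum_prod_type]
    simp only [chiSquare, Finset.mul_sum, σ]
  have h2 : ∀ a, ∫⁻ z, F a (z (σ a)) ∂(Measure.infinitePi fun _ : ℕ × ℕ => gaussianReal 0 1)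
      = ENNReal.ofReal ((1 + l a.1 * s a.1)⁻¹ ^ (1 / 2 : ℝ) *
          Real.exp (-(s a.1 / (1 + l a.1 * s a.1) *
            ((if a.2 = 0 then √(2 * v a.1) else 0) ^ 2 / 2)))) := by
    intro a
    rw [(measurePreserving_eval_infinitePi (fun _ : ℕ × ℕ => gaussianReal 0 1)
      (σ a)).lintegral_comp (hF a)]
    exact lintegral_exp_neg_sq_gaussianReal (hl _) (hs _) _
  rw [lintegral_congr h1, lintegral_prod_eq_prod_lintegral_of_indepFun _ _ hind
    (fun a => (hF a).comp (measurable_pi_apply _))]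
  simp only [h2]
  rw [← ENNReal.ofReal_prod_of_nonneg fun a _ => by
    have := hl a.1; have := hs a.1; positivity, Fintype.prod_prod_type]
  congr 1
  refine Finset.prod_congr rfl fun j _ => ?_
  have hpos : 0 < 1 + l j * s j := by have := hl j; have := hs j; positivity
  rw [Fin.prod_univ_succ]
  simp only [if_true, Fin.succ_ne_zero, if_false, Finset.prod_const, Finset.card_univ,
    Fintype.card_fin]
  rw [Real.sq_sqrt (by linarith [hv j])]
  have h3 : (1 + l j * s j)⁻¹ ^ (((d + 1 : ℕ) : ℝ) / 2)
      = (1 + l j * s j)⁻¹ ^ (1 / 2 : ℝ) * ((1 + l j * s j)⁻¹ ^ (1 / 2 : ℝ)) ^ d := by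
    rw [← pow_succ', ← Real.rpow_natCast, ← Real.rpow_mul (by positivity)]
    congr 1
    ring
  rw [h3]
  norm_num
  ring

/-- Given the gamma variable `y`, the conditional transform is a constant times the exponential of a
multiple of `-y`, so the outer integral is a gamma transform. -/
theorem lintegral_exp_neg_minorantVector (d : ℕ) {lam e : ℕ → ℝ} {c : ℝ} (n M : ℕ)
    (hc : 0 < c) (hlam : ∀ j, n ≤ j → 0 ≤ lam j) (he : ∀ j, n ≤ j → 0 ≤ e j)
    (s : Fin (M + 1) → ℝ≥0) :
    ∫⁻ ω, ENNReal.ofReal (Real.exp (-∑ i, (s i : ℝ) * minorantVector d lam e n M ω i))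
        ∂gammaGaussianMeasure (((d + 1 : ℕ) : ℝ) / 2) c
      = ENNReal.ofReal (minorantLaplace (((d + 1 : ℕ) : ℝ) / 2) c
          (fun j : Fin M => lam (n + j)) (fun j => e (n + j)) s) := by
  have hα : (0 : ℝ) < ((d + 1 : ℕ) : ℝ) / 2 := by positivity
  set α : ℝ := ((d + 1 : ℕ) : ℝ) / 2 with hα_def
  have := isProbabilityMeasure_gammaMeasure hα hc
  have hmeas : Measurable fun ω => ENNReal.ofReal
      (Real.exp (-∑ i, (s i : ℝ) * minorantVector d lam e n M ω i)) :=
    (measurable_laplaceKernel s).comp (measurable_minorantVector d lam e n M)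
  rw [gammaGaussianMeasure, lintegral_prod _ hmeas.aemeasurable]
  have hy : ∀ j : Fin M, 0 ≤ lam (n + j) := fun j => hlam _ (Nat.le_add_right _ _)
  have hK : 0 ≤ ∏ j : Fin M, (1 + lam (n + j) * s j.succ)⁻¹ ^ α :=
    Finset.prod_nonneg fun j _ => by have := hy j; positivity
  have hT : 0 ≤ ∑ j : Fin M, e (n + j) * (s j.succ / (1 + lam (n + j) * s j.succ)) :=
    Finset.sum_nonneg fun j _ => mul_nonneg (he _ (Nat.le_add_right _ _)) (by
      have := hy j; positivity)
  have key : ∀ᵐ y ∂gammaMeasure α c, ∫⁻ z, ENNReal.ofReal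
        (Real.exp (-∑ i, (s i : ℝ) * minorantVector d lam e n M (y, z) i))
        ∂(Measure.infinitePi fun _ : ℕ × ℕ => gaussianReal 0 1)
      = ENNReal.ofReal (∏ j : Fin M, (1 + lam (n + j) * s j.succ)⁻¹ ^ α) *
        ENNReal.ofReal (Real.exp (-((s 0 + ∑ j : Fin M, e (n + j) *
          (s j.succ / (1 + lam (n + j) * s j.succ))) * y))) := by
    filter_upwards [ae_nonneg_gammaMeasure α c] with y hy0
    have h1 : ∀ z : ℕ × ℕ → ℝ, ENNReal.ofReal
        (Real.exp (-∑ i, (s i : ℝ) * minorantVector d lam e n M (y, z) i))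
        = ENNReal.ofReal (Real.exp (-(s 0 * y))) * ENNReal.ofReal (Real.exp (-∑ j : Fin M,
          (s j.succ : ℝ) * chiSquare d (lam (n + j)) (e (n + j) * y) fun i => z (n + j, i))) := by
      intro z
      rw [← ENNReal.ofReal_mul (Real.exp_nonneg _), ← Real.exp_add, Fin.sum_univ_succ]
      simp only [minorantVector, Fin.cons_zero, Fin.cons_succ, Real.coe_toNNReal _ hy0,
        Real.coe_toNNReal _ (chiSquare_nonneg _ _ _ _)]
      rw [neg_add]
    rw [lintegral_congr h1, lintegral_const_mul' _ _ ENNReal.ofReal_ne_top,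
      lintegral_exp_neg_chiSquare d (n := n) hy (v := fun j : Fin M => e (n + j) * y)
        (fun j : Fin M => mul_nonneg (he _ (Nat.le_add_right _ _)) hy0)
        fun j => NNReal.coe_nonneg (s j.succ),
      ← ENNReal.ofReal_mul (Real.exp_nonneg _), ← ENNReal.ofReal_mul hK]
    congr 1
    rw [Finset.prod_mul_distrib, ← Real.exp_sum, mul_left_comm, ← Real.exp_add]
    congr 2
    rw [add_mul, Finset.sum_mul, neg_add, ← Finset.sum_neg_distrib]
    congr 1
    exact Finset.sum_congr rfl fun j _ => by ring
  rw [lintegral_congr_ae key, lintegral_const_mul _ (by fun_prop),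
    lintegral_exp_neg_gammaMeasure hα hc (by positivity), ← ENNReal.ofReal_mul hK,
    minorantLaplace, add_assoc]

theorem isLaplaceTransform_minorantLaplace (d : ℕ) {lam e : ℕ → ℝ} {c : ℝ} (n M : ℕ)
    (hc : 0 < c) (hlam : ∀ j, n ≤ j → 0 ≤ lam j) (he : ∀ j, n ≤ j → 0 ≤ e j) :
    IsLaplaceTransform (minorantLaplace (((d + 1 : ℕ) : ℝ) / 2) c
      (fun j : Fin M => lam (n + j)) (fun j => e (n + j))) := by
  refine ⟨fun s => ?_, (gammaGaussianMeasure (((d + 1 : ℕ) : ℝ) / 2) c).map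
    (minorantVector d lam e n M), fun s => ?_⟩
  · have h1 : ∀ j : Fin M, 0 ≤ lam (n + j) := fun j => hlam _ (Nat.le_add_right _ _)
    have h2 : ∀ j : Fin M, 0 ≤ e (n + j) := fun j => he _ (Nat.le_add_right _ _)
    refine mul_nonneg (Finset.prod_nonneg fun j _ => by have := h1 j; positivity)
      (Real.rpow_nonneg (div_nonneg hc.le (add_nonneg (by positivity)
        (Finset.sum_nonneg fun j _ => ?_))) _)
    have := h1 j
    have := h2 j
    positivity
  · rw [lintegral_map (measurable_laplaceKernel s) (measurable_minorantVector d lam e n M)]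
    exact lintegral_exp_neg_minorantVector d n M hc hlam he s

/-! ### Tails of the weighted series and the parameters of the minorants -/

/-- The tail `∑_{j ≥ n} u j / lam j`. -/
noncomputable def weightedTail (lam u : ℕ → ℝ) (n : ℕ) : ℝ := ∑' j : ℕ, u (n + j) / lam (n + j)

/-- The sequence `1 - f j`. -/
def deficit (f : ℕ → ℝ) (j : ℕ) : ℝ := 1 - f j

/-- The sequence `(1 - f j) * (1 - g j)`. -/
def deficitMul (f g : ℕ → ℝ) (j : ℕ) : ℝ := deficit f j * deficit g j

theorem weightedTail_eq (lam u : ℕ → ℝ) (n : ℕ) :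
    weightedTail lam u (n + 2) = ∑' j : ℕ, (fun j => u (j + 2) / lam (j + 2)) (j + n) := by
  unfold weightedTail
  refine tsum_congr fun j => ?_
  simp only
  rw [show n + 2 + j = j + n + 2 by ring]

theorem summable_weightedTail {lam u : ℕ → ℝ}
    (hs : Summable fun j : ℕ => u (j + 2) / lam (j + 2)) {n : ℕ} (hn : 2 ≤ n) :
    Summable fun j : ℕ => u (n + j) / lam (n + j) := by
  obtain ⟨k, rfl⟩ := Nat.exists_eq_add_of_le hn
  refine ((summable_nat_add_iff k).2 hs).congr fun j => ?_
  rw [show 2 + k + j = j + k + 2 by ring]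

theorem sum_add_weightedTail {lam u : ℕ → ℝ}
    (hs : Summable fun j : ℕ => u (j + 2) / lam (j + 2)) {n : ℕ} (hn : 2 ≤ n) (M : ℕ) :
    ∑ j : Fin M, u (n + j) / lam (n + j) + weightedTail lam u (n + M) = weightedTail lam u n := by
  have := Summable.sum_add_tsum_nat_add (f := fun j : ℕ => u (n + j) / lam (n + j)) M
    (summable_weightedTail hs hn)
  rw [Finset.sum_range] at this
  unfold weightedTail
  rw [← this]
  congr 1
  refine tsum_congr fun j => ?_
  rw [show n + M + j = n + (j + M) by ring]

theorem tendsto_weightedTail (lam u : ℕ → ℝ) :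
    Tendsto (weightedTail lam u) atTop (𝓝 0) := by
  rw [← tendsto_add_atTop_iff_nat 2]
  simp only [weightedTail_eq]
  exact tendsto_sum_nat_add fun j : ℕ => u (j + 2) / lam (j + 2)

theorem weightedTail_nonneg {lam u : ℕ → ℝ} {n : ℕ} (h : ∀ j, n ≤ j → 0 ≤ u j / lam j) :
    0 ≤ weightedTail lam u n :=
  tsum_nonneg fun _ => h _ (Nat.le_add_right _ _)

theorem weightedTail_mono {lam u v : ℕ → ℝ} (hu : Summable fun j : ℕ => u (j + 2) / lam (j + 2))
    (hv : Summable fun j : ℕ => v (j + 2) / lam (j + 2)) {n : ℕ} (hn : 2 ≤ n)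
    (h : ∀ j, n ≤ j → u j / lam j ≤ v j / lam j) :
    weightedTail lam u n ≤ weightedTail lam v n :=
  (summable_weightedTail hu hn).tsum_le_tsum (fun _ => h _ (Nat.le_add_right _ _))
    (summable_weightedTail hv hn)

theorem weightedTail_lt_one {lam u : ℕ → ℝ} (hs : Summable fun j : ℕ => u (j + 2) / lam (j + 2))
    (h0 : ∀ j, 2 ≤ j → 0 ≤ u j / lam j) (h1 : ∑' j : ℕ, u (j + 2) / lam (j + 2) < 1) {n : ℕ}
    (hn : 2 ≤ n) : weightedTail lam u n < 1 := by
  obtain ⟨k, rfl⟩ := Nat.exists_eq_add_of_le hn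
  have h2 := sum_add_weightedTail hs le_rfl k
  have h3 : 0 ≤ ∑ j : Fin k, u (2 + j) / lam (2 + j) :=
    Finset.sum_nonneg fun j _ => h0 _ (Nat.le_add_right _ _)
  have h4 : weightedTail lam u 2 = ∑' j : ℕ, u (j + 2) / lam (j + 2) := by
    simpa using weightedTail_eq lam u 0
  linarith

/-- The labels `0, n, n + 1, …, n + M - 1`. -/
def tailLabel (n M : ℕ) : Fin (M + 1) → ℕ := Fin.cons 0 fun j : Fin M => n + j

/-- The points `0, 1/n, 1/(n + 1), …, 1/(n + M - 1)` of `T`. -/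
noncomputable def tailPt (n M : ℕ) : Fin (M + 1) → T :=
  Fin.cons zeroPt fun j : Fin M => invPt (n + j)

theorem label_tailPt {n : ℕ} (hn : 2 ≤ n) (M : ℕ) (i : Fin (M + 1)) :
    label (tailPt n M i) = tailLabel n M i := by
  refine Fin.cases ?_ (fun j => ?_) i
  · simp [tailPt, tailLabel, label_zeroPt]
  · simp [tailPt, tailLabel, label_invPt (show 2 ≤ n + (j : ℕ) by omega)]

theorem tailLabel_injective {n : ℕ} (hn : 2 ≤ n) (M : ℕ) : Function.Injective (tailLabel n M) := by
  refine Fin.cons_injective_iff.2 ⟨?_, fun i j h => ?_⟩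
  · rintro ⟨j, hj⟩
    simp only at hj
    omega
  · simp only [add_right_inj] at h
    exact Fin.ext h

/-- The rate of the gamma variable of the minorant which starts at the index `n`. -/
noncomputable def tailRate (lam f g : ℕ → ℝ) (n : ℕ) : ℝ :=
  minorantRate (weightedTail lam (deficit f) n) (weightedTail lam (deficit g) n)
    (weightedTail lam (deficitMul f g) n)

/-- The shrinking factors of the minorant which starts at the index `n`. -/
noncomputable def tailFactor (lam f g : ℕ → ℝ) (n j : ℕ) : ℝ :=
  minorantFactor (weightedTail lam (deficit f) n) (weightedTail lam (deficit g) n)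
    (weightedTail lam (deficitMul f g) n) (deficit f j) (deficit g j)

/-- The mass of the minorant which starts at the index `n`. -/
noncomputable def tailMass (lam f g : ℕ → ℝ) (α : ℝ) (n : ℕ) : ℝ :=
  ((2 + weightedTail lam (deficitMul f g) n) * tailRate lam f g n) ^ (-α)

/-- All three tails vanish in the limit, so `a` and `b` tend to `1 / 2`, the rate tends to `1 / 2`,
and the mass tends to `(2 * (1 / 2)) ^ (-α) = 1`. -/
theorem tendsto_tailMass (lam f g : ℕ → ℝ) (α : ℝ) : Tendsto (tailMass lam f g α) atTop (𝓝 1) := by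
  have hp := tendsto_weightedTail lam (deficit f)
  have hq := tendsto_weightedTail lam (deficit g)
  have hr := tendsto_weightedTail lam (deficitMul f g)
  have hb := (hq.const_add 1).div (hr.const_add 2) (by norm_num)
  have ha := (hp.const_add 1).div (hr.const_add 2) (by norm_num)
  have hrate : Tendsto (tailRate lam f g) atTop (𝓝 (1 / 2)) := by
    have := (hb.const_sub 1).add (ha.mul (hq.sub (hb.mul hr)))
    norm_num at this
    exact this
  have := ((hr.const_add 2).mul hrate).rpow_const (p := -α) (Or.inl (by norm_num))
  norm_num at this
  exact this

/-! ### Admissible sequences and the comparison of laws -/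

namespace Admissible

variable {lam f g : ℕ → ℝ}

theorem summable_f (h : Admissible lam f g) :
    Summable fun j : ℕ => deficit f (j + 2) / lam (j + 2) := h.f_summable

theorem summable_g (h : Admissible lam f g) :
    Summable fun j : ℕ => deficit g (j + 2) / lam (j + 2) := h.g_summable

theorem deficit_f_pos (h : Admissible lam f g) {j : ℕ} (hj : 2 ≤ j) : 0 < deficit f j :=
  sub_pos.2 (h.f_mem j hj).2

theorem deficit_g_pos (h : Admissible lam f g) {j : ℕ} (hj : 2 ≤ j) : 0 < deficit g j :=
  sub_pos.2 (h.g_mem j hj).2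

theorem deficit_f_le_one (h : Admissible lam f g) {j : ℕ} (hj : 2 ≤ j) : deficit f j ≤ 1 := by
  have := (h.f_mem j hj).1
  unfold deficit; linarith

theorem deficit_g_le_one (h : Admissible lam f g) {j : ℕ} (hj : 2 ≤ j) : deficit g j ≤ 1 := by
  have := (h.g_mem j hj).1
  unfold deficit; linarith

theorem deficitMul_div_nonneg (h : Admissible lam f g) {j : ℕ} (hj : 2 ≤ j) :
    0 ≤ deficitMul f g j / lam j :=
  div_nonneg (mul_nonneg (h.deficit_f_pos hj).le (h.deficit_g_pos hj).le) (h.lam_pos j hj).le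

theorem deficitMul_div_le_f (h : Admissible lam f g) {j : ℕ} (hj : 2 ≤ j) :
    deficitMul f g j / lam j ≤ deficit f j / lam j :=
  div_le_div_of_nonneg_right (mul_le_of_le_one_right (h.deficit_f_pos hj).le
    (h.deficit_g_le_one hj)) (h.lam_pos j hj).le

theorem deficitMul_div_le_g (h : Admissible lam f g) {j : ℕ} (hj : 2 ≤ j) :
    deficitMul f g j / lam j ≤ deficit g j / lam j :=
  div_le_div_of_nonneg_right (mul_le_of_le_one_left (h.deficit_g_pos hj).le
    (h.deficit_f_le_one hj)) (h.lam_pos j hj).le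

theorem summable_mul (h : Admissible lam f g) :
    Summable fun j : ℕ => deficitMul f g (j + 2) / lam (j + 2) :=
  Summable.of_nonneg_of_le (fun _ => h.deficitMul_div_nonneg (by omega))
    (fun _ => h.deficitMul_div_le_f (by omega)) h.summable_f

theorem weightedTail_mul_le_f (h : Admissible lam f g) {n : ℕ} (hn : 2 ≤ n) :
    weightedTail lam (deficitMul f g) n ≤ weightedTail lam (deficit f) n :=
  weightedTail_mono h.summable_mul h.summable_f hn fun _ hj =>
    h.deficitMul_div_le_f (hn.trans hj)

theorem weightedTail_mul_le_g (h : Admissible lam f g) {n : ℕ} (hn : 2 ≤ n) :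
    weightedTail lam (deficitMul f g) n ≤ weightedTail lam (deficit g) n :=
  weightedTail_mono h.summable_mul h.summable_g hn fun _ hj =>
    h.deficitMul_div_le_g (hn.trans hj)

theorem weightedTail_mul_nonneg (h : Admissible lam f g) {n : ℕ} (hn : 2 ≤ n) :
    0 ≤ weightedTail lam (deficitMul f g) n :=
  weightedTail_nonneg fun _ hj => h.deficitMul_div_nonneg (hn.trans hj)

theorem weightedTail_f_lt_one (h : Admissible lam f g) {n : ℕ} (hn : 2 ≤ n) :
    weightedTail lam (deficit f) n < 1 :=
  weightedTail_lt_one h.summable_f (fun j hj => div_nonneg (h.deficit_f_pos hj).le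
    (h.lam_pos j hj).le) h.f_sum_lt hn

theorem weightedTail_g_lt_one (h : Admissible lam f g) {n : ℕ} (hn : 2 ≤ n) :
    weightedTail lam (deficit g) n < 1 :=
  weightedTail_lt_one h.summable_g (fun j hj => div_nonneg (h.deficit_g_pos hj).le
    (h.lam_pos j hj).le) h.g_sum_lt hn

theorem tailRate_pos (h : Admissible lam f g) {n : ℕ} (hn : 2 ≤ n) : 0 < tailRate lam f g n :=
  minorantRate_pos ((h.weightedTail_mul_nonneg hn).trans (h.weightedTail_mul_le_f hn))
    (h.weightedTail_g_lt_one hn) (h.weightedTail_mul_nonneg hn) (h.weightedTail_mul_le_g hn)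

theorem tailFactor_nonneg (h : Admissible lam f g) {n : ℕ} (hn : 2 ≤ n) {j : ℕ} (hj : 2 ≤ j) :
    0 ≤ tailFactor lam f g n j :=
  minorantFactor_nonneg ((h.weightedTail_mul_nonneg hn).trans (h.weightedTail_mul_le_f hn))
    (h.weightedTail_f_lt_one hn)
    ((h.weightedTail_mul_nonneg hn).trans (h.weightedTail_mul_le_g hn))
    (h.weightedTail_g_lt_one hn) (h.weightedTail_mul_nonneg hn)
    (h.deficit_f_le_one hj) (h.deficit_g_le_one hj)

/-- The determinant which determines the joint law at the points `0, 1/n, …, 1/(n + M - 1)`. -/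
theorem det_tail (h : Admissible lam f g) {n : ℕ} (hn : 2 ≤ n) (M : ℕ) (s : Fin (M + 1) → ℝ≥0) :
    (1 + (Matrix.of fun i j => U lam f g (tailPt n M i) (tailPt n M j))
        * Matrix.diagonal (fun i => (s i : ℝ))).det
      = (∏ j : Fin M, (1 + lam (n + j) * s j.succ)) *
        ((1 + s 0 + ∑ j : Fin M, s j.succ / (1 + lam (n + j) * s j.succ)) *
            (2 + ∑ j : Fin M, s j.succ / (1 + lam (n + j) * s j.succ) *
              deficitMul f g (n + j))
          - (1 + ∑ j : Fin M, s j.succ / (1 + lam (n + j) * s j.succ) * deficit f (n + j)) *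
            (1 + ∑ j : Fin M, s j.succ / (1 + lam (n + j) * s j.succ) * deficit g (n + j))) := by
  have hlam : ∀ i, 0 ≤ lam (tailLabel n M i) := by
    refine Fin.cases ?_ fun j => ?_
    · simp [tailLabel, h.lam_zero]
    · simpa [tailLabel] using (h.lam_pos (n + j) (by omega)).le
  have hmat : (Matrix.of fun i j => U lam f g (tailPt n M i) (tailPt n M j))
      = Matrix.of fun i j => (if i = j then lam (tailLabel n M i) else 0) + 1
          + f (tailLabel n M i) * g (tailLabel n M j) := by
    ext i j
    simp only [Matrix.of_apply, U, G, label_tailPt hn, (tailLabel_injective hn M).eq_iff]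
  rw [hmat, det_one_add_rank_two_mul_diagonal _ _ _ _ fun i => by
    have := hlam i; positivity]
  rw [Fin.prod_univ_succ, Fin.sum_univ_succ, Fin.sum_univ_succ, Fin.sum_univ_succ,
    Fin.sum_univ_succ]
  simp only [tailLabel, Fin.cons_zero, Fin.cons_succ, h.lam_zero, h.f_zero, h.g_zero, zero_mul,
    add_zero, div_one, one_mul, mul_one]
  have e1 : ∑ j : Fin M, (s j.succ : ℝ) / (1 + lam (n + j) * s j.succ) * (f (n + j) * g (n + j))
      = ∑ j : Fin M, (s j.succ : ℝ) / (1 + lam (n + j) * s j.succ)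
        - ∑ j : Fin M, (s j.succ : ℝ) / (1 + lam (n + j) * s j.succ) * deficit f (n + j)
        - ∑ j : Fin M, (s j.succ : ℝ) / (1 + lam (n + j) * s j.succ) * deficit g (n + j)
        + ∑ j : Fin M, (s j.succ : ℝ) / (1 + lam (n + j) * s j.succ) *
              deficitMul f g (n + j) := by
    rw [← Finset.sum_sub_distrib, ← Finset.sum_sub_distrib, ← Finset.sum_add_distrib]
    exact Finset.sum_congr rfl fun j _ => by simp only [deficitMul, deficit]; ring
  have e2 : ∑ j : Fin M, (s j.succ : ℝ) / (1 + lam (n + j) * s j.succ) * f (n + j)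
      = ∑ j : Fin M, (s j.succ : ℝ) / (1 + lam (n + j) * s j.succ)
        - ∑ j : Fin M, (s j.succ : ℝ) / (1 + lam (n + j) * s j.succ) * deficit f (n + j) := by
    rw [← Finset.sum_sub_distrib]
    exact Finset.sum_congr rfl fun j _ => by simp only [deficit]; ring
  have e3 : ∑ j : Fin M, (s j.succ : ℝ) / (1 + lam (n + j) * s j.succ) * g (n + j)
      = ∑ j : Fin M, (s j.succ : ℝ) / (1 + lam (n + j) * s j.succ)
        - ∑ j : Fin M, (s j.succ : ℝ) / (1 + lam (n + j) * s j.succ) * deficit g (n + j) := by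
    rw [← Finset.sum_sub_distrib]
    exact Finset.sum_congr rfl fun j _ => by simp only [deficit]; ring
  rw [e1, e2, e3]
  ring

/-- The law of a `(d + 1)/2`-permanental process at the points `0, 1/n, 1/(n + 1), …` is bounded
below by a multiple of the law of the minorant process. -/
theorem minorant_le (h : Admissible lam f g) {Ω : Type*} [MeasurableSpace Ω]
    {P : Measure Ω} [IsProbabilityMeasure P]
    {d : ℕ} {X : T → Ω → ℝ} (hX : IsPermanentalProcess P (((d + 1 : ℕ) : ℝ) / 2) (U lam f g) X)
    {n : ℕ} (hn : 2 ≤ n) (M : ℕ) {A : Set (Fin (M + 1) → ℝ≥0)} (hA : MeasurableSet A) :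
    ENNReal.ofReal (tailMass lam f g (((d + 1 : ℕ) : ℝ) / 2) n) *
        gammaGaussianMeasure (((d + 1 : ℕ) : ℝ) / 2) (tailRate lam f g n)
          {ω | minorantVector d lam (tailFactor lam f g n) n M ω ∈ A}
      ≤ P {ω | (fun i => (X (tailPt n M i) ω).toNNReal) ∈ A} := by
  have hα : (0 : ℝ) < ((d + 1 : ℕ) : ℝ) / 2 := by positivity
  set α : ℝ := ((d + 1 : ℕ) : ℝ) / 2 with hα_def
  have hV := hX (M + 1) (tailPt n M)
  have hrate := h.tailRate_pos hn
  have hlam : ∀ j, n ≤ j → 0 < lam j := fun j hj => h.lam_pos j (by omega)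
  have hfac : ∀ j, n ≤ j → 0 ≤ tailFactor lam f g n j := fun j hj =>
    h.tailFactor_nonneg hn (by omega)
  have hr := sum_add_weightedTail h.summable_mul hn M
  have hp := sum_add_weightedTail h.summable_f hn M
  have hq := sum_add_weightedTail h.summable_g hn M
  have hr0 := h.weightedTail_mul_nonneg (show 2 ≤ n + M by omega)
  have hrp := h.weightedTail_mul_le_f (show 2 ≤ n + M by omega)
  have hrq := h.weightedTail_mul_le_g (show 2 ≤ n + M by omega)
  have hmin := isLaplaceTransform_minorantLaplace d n M hrate (fun j hj => (hlam j hj).le) hfac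
  -- The full tails from `n` minus the window sums are the tails from `n + M`, so the conditions on
  -- the constant terms reduce to the comparison of those tails.
  obtain ⟨V, ⟨hV0, ν, hν⟩, hdec⟩ : ∃ V : (Fin (M + 1) → ℝ≥0) → ℝ, IsLaplaceTransform V ∧
      ∀ s : Fin (M + 1) → ℝ≥0,
        1 / ((1 + (Matrix.of fun i j => U lam f g (tailPt n M i) (tailPt n M j))
          * Matrix.diagonal (fun i => (s i : ℝ))).det) ^ α
        = tailMass lam f g α n * minorantLaplace α (tailRate lam f g n)
            (fun j : Fin M => lam (n + j)) (fun j => tailFactor lam f g n (n + j)) s + V s := by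
    simp only [h.det_tail hn M]
    refine laplace_decomposition (φ := fun j : Fin M => deficit f (n + j))
      (γ := fun j : Fin M => deficit g (n + j)) hα (fun j => hlam _ (Nat.le_add_right _ _))
      (fun j => ⟨(h.deficit_f_pos (by omega)).le, h.deficit_f_le_one (by omega)⟩)
      (fun j => ⟨(h.deficit_g_pos (by omega)).le, h.deficit_g_le_one (by omega)⟩)
      (h.weightedTail_f_lt_one hn) (h.weightedTail_g_lt_one hn) ?_ ?_ ?_ hmin
    · change ∑ j : Fin M, deficitMul f g (n + j) / lam (n + j) ≤ _
      linarith
    · change _ - ∑ j : Fin M, deficitMul f g (n + j) / lam (n + j) ≤ _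
      linarith
    · change _ - ∑ j : Fin M, deficitMul f g (n + j) / lam (n + j) ≤ _
      linarith
  have hm0 : 0 ≤ tailMass lam f g α n := Real.rpow_nonneg
    (mul_nonneg (by linarith [h.weightedTail_mul_nonneg hn]) hrate.le) _
  have hmeas : Measurable fun ω i => (X (tailPt n M i) ω).toNNReal :=
    measurable_pi_iff.2 fun i => (hV.measurable i).real_toNNReal
  have hmv := measurable_minorantVector d lam (tailFactor lam f g n) n M
  have := isFiniteMeasure_of_laplace hν
  have := isProbabilityMeasure_gammaMeasure hα hrate
  have : IsProbabilityMeasure (gammaGaussianMeasure α (tailRate lam f g n)) := by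
    unfold gammaGaussianMeasure; infer_instance
  have hlaw : P.map (fun ω i => (X (tailPt n M i) ω).toNNReal)
      = ENNReal.ofReal (tailMass lam f g α n) •
          (gammaGaussianMeasure α (tailRate lam f g n)).map
            (minorantVector d lam (tailFactor lam f g n) n M) + ν := by
    have hfin : IsFiniteMeasure (ENNReal.ofReal (tailMass lam f g α n) •
          (gammaGaussianMeasure α (tailRate lam f g n)).map
            (minorantVector d lam (tailFactor lam f g n) n M)) :=
      Measure.smul_finite _ ENNReal.ofReal_ne_top
    refine ext_of_laplace fun s => ?_
    rw [lintegral_map (measurable_laplaceKernel s) hmeas, lintegral_add_measure,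
      lintegral_smul_measure, lintegral_map (measurable_laplaceKernel s) hmv, hν,
      lintegral_exp_neg_minorantVector d n M hrate (fun j hj => (hlam j hj).le) hfac, smul_eq_mul,
      ← ENNReal.ofReal_mul hm0, ← ENNReal.ofReal_add (mul_nonneg hm0 ?_) (hV0 s)]
    · have h1 : ∀ ω, ENNReal.ofReal (Real.exp (-∑ i, (s i : ℝ) *
            (X (tailPt n M i) ω).toNNReal))
          = ENNReal.ofReal (Real.exp (-∑ i, (s i : ℝ) * X (tailPt n M i) ω)) := fun ω => by
        simp only [Real.coe_toNNReal _ (hV.nonneg _ ω)]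
      rw [lintegral_congr h1, ← ofReal_integral_eq_lintegral_ofReal ?_
        (ae_of_all _ fun ω => Real.exp_nonneg _)]
      · rw [hV.laplace (fun i => (s i : ℝ)) fun i => (s i).2, hdec s]
      · refine Integrable.of_bound (C := 1) ?_ (ae_of_all _ fun ω => ?_)
        · have := hV.measurable
          exact (by fun_prop : Measurable fun ω =>
            Real.exp (-∑ i, (s i : ℝ) * X (tailPt n M i) ω)).aestronglyMeasurable
        · rw [Real.norm_of_nonneg (Real.exp_nonneg _), Real.exp_le_one_iff, neg_nonpos]
          exact Finset.sum_nonneg fun i _ => mul_nonneg (s i).2 (hV.nonneg i ω)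
    · exact (isLaplaceTransform_minorantLaplace d n M hrate
        (fun j hj => (hlam j hj).le) hfac).1 s
  have h2 := congrArg (fun μ => μ A) hlaw
  simp only [Measure.add_apply, Measure.smul_apply, smul_eq_mul] at h2
  rw [Measure.map_apply hmeas hA, Measure.map_apply hmv hA] at h2
  calc _ ≤ _ := le_self_add
    _ = _ := h2.symm

end Admissible

/-! ### Normal tails and the growth of normal sequences -/

/-- The Chernoff bound with the optimal parameter `t`. -/
theorem gaussianReal_Ici_le {t : ℝ} (ht : 0 ≤ t) :
    gaussianReal 0 1 (Set.Ici t) ≤ ENNReal.ofReal (Real.exp (-(t ^ 2 / 2))) := by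
  have h := measure_ge_le_exp_mul_mgf (X := id) (μ := gaussianReal 0 1) t ht
    (integrable_exp_mul_gaussianReal t)
  rw [mgf_id_gaussianReal, ← Real.exp_add] at h
  have h2 : {ω : ℝ | t ≤ id ω} = Set.Ici t := rfl
  rw [h2, Measure.real, ← ENNReal.le_ofReal_iff_toReal_le (measure_ne_top _ _)
    (Real.exp_nonneg _)] at h
  refine h.trans (ENNReal.ofReal_le_ofReal (Real.exp_le_exp.2 (le_of_eq ?_)))
  simp only [NNReal.coe_one]
  ring

/-- The density on `[t, t + 1]` is at least its value at the right end. The loss from `t` to `t + 1`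
is harmless at the scale `√(log n)`. -/
theorem le_gaussianReal_Ici {t : ℝ} (ht : 0 ≤ t) :
    ENNReal.ofReal ((√(2 * Real.pi))⁻¹ * Real.exp (-((t + 1) ^ 2 / 2)))
      ≤ gaussianReal 0 1 (Set.Ici t) := by
  rw [gaussianReal_apply 0 one_ne_zero]
  calc ENNReal.ofReal ((√(2 * Real.pi))⁻¹ * Real.exp (-((t + 1) ^ 2 / 2)))
      = ∫⁻ _ in Set.Icc t (t + 1),
          ENNReal.ofReal ((√(2 * Real.pi))⁻¹ * Real.exp (-((t + 1) ^ 2 / 2))) := by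
        rw [setLIntegral_const, Real.volume_Icc]
        simp
    _ ≤ ∫⁻ x in Set.Icc t (t + 1), gaussianPDF 0 1 x := by
        refine setLIntegral_mono (measurable_gaussianPDF _ _) fun x hx => ?_
        refine ENNReal.ofReal_le_ofReal ?_
        simp only [gaussianPDFReal, NNReal.coe_one, mul_one, sub_zero]
        refine mul_le_mul_of_nonneg_left (Real.exp_le_exp.2 ?_) (by positivity)
        have := hx.1
        have := hx.2
        rw [neg_div]
        refine neg_le_neg ?_
        nlinarith
    _ ≤ ∫⁻ x in Set.Ici t, gaussianPDF 0 1 x :=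
        lintegral_mono_set Set.Icc_subset_Ici_self

section NormalSequence

variable {Ω : Type*} [MeasurableSpace Ω] {Q : Measure Ω} {W : ℕ → Ω → ℝ}

/-- First Borel–Cantelli: the exceptional probabilities are at most `n ^ (-c / 2)`, with `c / 2 >
1`. Independence plays no role. -/
theorem ae_eventually_lt_sqrt_log (hW : ∀ n, Measurable (W n))
    (hlaw : ∀ n, Q.map (W n) = gaussianReal 0 1) {c : ℝ} (hc : 2 < c) :
    ∀ᵐ ω ∂Q, ∀ᶠ n : ℕ in atTop, W n ω < √(c * Real.log n) := by
  have hsum : Summable fun n : ℕ => Real.exp (-(c * Real.log n / 2)) := by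
    rw [← summable_nat_add_iff 1]
    have h1 : (1 : ℝ) < c / 2 := by linarith
    refine ((summable_nat_add_iff 1).2 (Real.summable_one_div_nat_rpow.2 h1)).congr fun n => ?_
    have hn : (0 : ℝ) < ((n + 1 : ℕ) : ℝ) := by positivity
    rw [one_div, ← Real.rpow_neg hn.le, Real.rpow_def_of_pos hn]
    congr 1
    ring
  have hle : ∀ n : ℕ, Q (W n ⁻¹' Set.Ici (√(c * Real.log n)))
      ≤ ENNReal.ofReal (Real.exp (-(c * Real.log n / 2))) := by
    intro n
    rw [← Measure.map_apply (hW n) measurableSet_Ici, hlaw]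
    refine (gaussianReal_Ici_le (Real.sqrt_nonneg _)).trans (le_of_eq ?_)
    rw [Real.sq_sqrt (mul_nonneg (by linarith) (Real.log_natCast_nonneg n))]
  have hne : ∑' n : ℕ, Q (W n ⁻¹' Set.Ici (√(c * Real.log n))) ≠ ∞ := by
    refine ne_top_of_le_ne_top ?_ (ENNReal.tsum_le_tsum hle)
    rw [← ENNReal.ofReal_tsum_of_nonneg (fun n => Real.exp_nonneg _) hsum]
    exact ENNReal.ofReal_ne_top
  filter_upwards [ae_eventually_notMem hne] with ω hω
  filter_upwards [hω] with n hn
  simpa using hn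

theorem tendsto_log_natCast : Tendsto (fun n : ℕ => Real.log n) atTop atTop :=
  Real.tendsto_log_atTop.comp tendsto_natCast_atTop_atTop

/-- Second Borel–Cantelli: the probabilities dominate a multiple of the harmonic series. -/
theorem ae_frequently_sqrt_log_le (hW : ∀ n, Measurable (W n)) (hind : iIndepFun W Q)
    (hlaw : ∀ n, Q.map (W n) = gaussianReal 0 1) {c : ℝ} (hc0 : 0 ≤ c) (hc : c < 2) :
    ∀ᵐ ω ∂Q, ∃ᶠ n : ℕ in atTop, √(c * Real.log n) ≤ W n ω := by
  have := hind.isProbabilityMeasure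
  let S : ℕ → Set Ω := fun n => W n ⁻¹' Set.Ici (√(c * Real.log n))
  have hS : ∀ n, MeasurableSet (S n) := fun n => hW n measurableSet_Ici
  have hSind : iIndepSet S Q := by
    rw [iIndepSet_iff_meas_biInter hS]
    exact fun s => hind.measure_inter_preimage_eq_mul s fun _ _ => measurableSet_Ici
  have hlow : ∀ᶠ n : ℕ in atTop, (√(2 * Real.pi))⁻¹ * (1 / (n : ℝ)) ≤ (Q (S n)).toReal := by
    have h1 : Tendsto (fun L : ℝ => (c - 2) + (2 * √c * (√L)⁻¹ + L⁻¹)) atTop (𝓝 (c - 2)) := by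
      have h2 : Tendsto (fun L : ℝ => (√L)⁻¹) atTop (𝓝 0) :=
        tendsto_inv_atTop_zero.comp Real.tendsto_sqrt_atTop
      have := ((h2.const_mul (2 * √c)).add tendsto_inv_atTop_zero).const_add (c - 2)
      simpa using this
    -- With `L = log n` this makes the lower tail bound at least a multiple of `exp (-L) = 1 / n`.
    -- The strict inequality `c < 2` absorbs the cross term `2 √c √L`.
    have h3 : ∀ᶠ L : ℝ in atTop, (√(c * L) + 1) ^ 2 / 2 ≤ L := by
      filter_upwards [h1.eventually (gt_mem_nhds (show c - 2 < 0 by linarith)),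
        eventually_gt_atTop 0] with L hL hL0
      have hs : 0 < √L := Real.sqrt_pos.2 hL0
      have hLs : L = √L ^ 2 := (Real.sq_sqrt hL0.le).symm
      have hcs : √c ^ 2 = c := Real.sq_sqrt hc0
      rw [Real.sqrt_mul hc0]
      have h4 : ((c - 2) + (2 * √c * (√L)⁻¹ + L⁻¹)) * L = (c - 2) * L + 2 * √c * √L + 1 := by
        have : (√L)⁻¹ * L = √L := by
          nth_rewrite 2 [hLs]
          field_simp
        have h7 : L⁻¹ * L = 1 := inv_mul_cancel₀ hL0.ne'
        linear_combination (2 * √c) * this + h7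
      have h5 := mul_neg_of_neg_of_pos hL hL0
      rw [h4] at h5
      have h6 : (√c * √L + 1) ^ 2 = c * L + 2 * √c * √L + 1 := by
        rw [add_sq, mul_pow, hcs, ← hLs]; ring
      rw [h6]
      linarith
    filter_upwards [tendsto_log_natCast.eventually h3, eventually_gt_atTop 0] with n hn hn0
    have hn0' : (0 : ℝ) < n := by exact_mod_cast hn0
    have h4 := le_gaussianReal_Ici (Real.sqrt_nonneg (c * Real.log n))
    rw [← hlaw n, Measure.map_apply (hW n) measurableSet_Ici,
      ENNReal.ofReal_le_iff_le_toReal (measure_ne_top _ _)] at h4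
    refine le_trans (mul_le_mul_of_nonneg_left ?_ (by positivity)) h4
    rw [one_div]
    nth_rewrite 1 [← Real.exp_log hn0']
    rw [← Real.exp_neg]
    exact Real.exp_le_exp.2 (neg_le_neg hn)
  have hdiv : ∑' n, Q (S n) = ∞ := by
    by_contra hne
    have hsum := ENNReal.summable_toReal hne
    obtain ⟨N, hN⟩ := eventually_atTop.1 hlow
    have h5 : Summable fun n : ℕ => (√(2 * Real.pi))⁻¹ * (1 / ((n + N : ℕ) : ℝ)) :=
      Summable.of_nonneg_of_le (fun n => by positivity)
        (fun n => hN (n + N) (Nat.le_add_left _ _)) ((summable_nat_add_iff N).2 hsum)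
    rw [summable_mul_left_iff (by positivity)] at h5
    exact Real.not_summable_one_div_natCast
      ((summable_nat_add_iff (f := fun n : ℕ => 1 / (n : ℝ)) N).1 h5)
  have h1 := measure_limsup_eq_one hS hSind hdiv
  have h2 := (mem_ae_iff_prob_eq_one (MeasurableSet.measurableSet_limsup hS)).2 h1
  filter_upwards [h2] with ω hω
  exact mem_limsup_iff_frequently_mem.1 hω

theorem ae_eventually_sq_le_log (hW : ∀ n, Measurable (W n))
    (hlaw : ∀ n, Q.map (W n) = gaussianReal 0 1) {c : ℝ} (hc : 2 < c) :
    ∀ᵐ ω ∂Q, ∀ᶠ n : ℕ in atTop, W n ω ^ 2 ≤ c * Real.log n := by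
  have hlaw' : ∀ n, Q.map (fun ω => -W n ω) = gaussianReal 0 1 := by
    intro n
    have h1 := gaussianReal_map_neg (μ := 0) (v := 1)
    rw [← hlaw n, Measure.map_map measurable_neg (hW n)] at h1
    rw [neg_zero] at h1
    exact h1
  filter_upwards [ae_eventually_lt_sqrt_log hW hlaw hc,
    ae_eventually_lt_sqrt_log (W := fun n ω => -W n ω) (fun n => (hW n).neg) hlaw' hc] with ω h1 h2
  filter_upwards [h1, h2] with n hn1 hn2
  have h3 : 0 ≤ c * Real.log n := mul_nonneg (by linarith) (Real.log_natCast_nonneg n)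
  rw [← Real.sq_sqrt h3]
  exact sq_le_sq' (by linarith) hn1.le

theorem ae_frequently_le_neg_sqrt_log (hW : ∀ n, Measurable (W n)) (hind : iIndepFun W Q)
    (hlaw : ∀ n, Q.map (W n) = gaussianReal 0 1) {c : ℝ} (hc0 : 0 ≤ c) (hc : c < 2) :
    ∀ᵐ ω ∂Q, ∃ᶠ n : ℕ in atTop, W n ω ≤ -√(c * Real.log n) := by
  have hlaw' : ∀ n, Q.map (fun ω => -W n ω) = gaussianReal 0 1 := by
    intro n
    have h1 := gaussianReal_map_neg (μ := 0) (v := 1)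
    rw [← hlaw n, Measure.map_map measurable_neg (hW n)] at h1
    rw [neg_zero] at h1
    exact h1
  filter_upwards [ae_frequently_sqrt_log_le (W := fun n ω => -W n ω) (fun n => (hW n).neg)
    (hind.comp (fun _ x => -x) fun _ => measurable_neg) hlaw' hc0 hc] with ω h
  exact h.mono fun n hn => by linarith

end NormalSequence

/-! ### Oscillation of noncentral chi-square variables -/

/-- The cross term of the shifted square is linear in `z 0` and drives the oscillation. The pure
squares and the shrinkage `1 - e` are lower order. -/
theorem chiSquare_sub (d : ℕ) {e y : ℝ} {l : ℝ} (hl : 0 ≤ l) (he : 0 ≤ e) (hy : 0 ≤ y)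
    (z : ℕ → ℝ) :
    chiSquare d l (e * y) z - y
      = √l * z 0 * √(2 * y * e) + (l * (∑ i : Fin (d + 1), z i ^ 2) / 2 - (1 - e) * y) := by
  have h1 : √l ^ 2 = l := Real.sq_sqrt hl
  have h2 : √(2 * y * e) ^ 2 = 2 * y * e := Real.sq_sqrt (by positivity)
  have h3 : ∑ i : Fin d, (√l * z i.succ) ^ 2 / 2 = l * (∑ i : Fin d, z i.succ ^ 2) / 2 := by
    rw [Finset.mul_sum, Finset.sum_div]
    exact Finset.sum_congr rfl fun i _ => by rw [mul_pow, h1]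
  unfold chiSquare
  rw [Fin.sum_univ_succ, Fin.sum_univ_succ]
  simp only [if_true, Fin.succ_ne_zero, if_false, add_zero, Fin.val_zero]
  rw [h3, show 2 * (e * y) = 2 * y * e by ring]
  linear_combination (z 0 ^ 2 / 2) * h1 + h2 / 2

section Deterministic

variable {lam e : ℕ → ℝ} {z : ℕ → ℕ → ℝ}

/-- The squares contribute at most a multiple of `lam n * log n`, which is the square of the
normalization, and the normalization tends to `0`. The shrinkage term vanishes by assumption. -/
theorem tendsto_chiSquare_remainder (d : ℕ) (hlam : ∀ n, 2 ≤ n → 0 < lam n)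
    (hlim : Tendsto (fun n : ℕ => lam n * Real.log n) atTop (𝓝 0))
    (he : Tendsto (fun n : ℕ => (1 - e n) / √(lam n * Real.log n)) atTop (𝓝 0))
    (hz : ∀ i, ∀ᶠ n : ℕ in atTop, z n i ^ 2 ≤ 3 * Real.log n) (y : ℝ) :
    Tendsto (fun n : ℕ => (lam n * (∑ i : Fin (d + 1), z n i ^ 2) / 2 - (1 - e n) * y)
      / √(lam n * Real.log n)) atTop (𝓝 0) := by
  have h1 : Tendsto (fun n : ℕ => lam n * (∑ i : Fin (d + 1), z n i ^ 2) / 2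
      / √(lam n * Real.log n)) atTop (𝓝 0) := by
    have h2 : Tendsto (fun n : ℕ => (3 * ((d : ℝ) + 1) / 2) * √(lam n * Real.log n))
        atTop (𝓝 0) := by
      have := (hlim.sqrt).const_mul (3 * ((d : ℝ) + 1) / 2)
      simpa using this
    refine squeeze_zero' ?_ ?_ h2
    · filter_upwards [eventually_ge_atTop 2] with n hn
      have := hlam n hn
      positivity
    · have hz' : ∀ᶠ n : ℕ in atTop, ∀ i : Fin (d + 1), z n i ^ 2 ≤ 3 * Real.log n :=
        eventually_all.2 fun i => hz i
      filter_upwards [hz', eventually_ge_atTop 2] with n hn h2n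
      have hl := hlam n h2n
      have hlog : 0 < Real.log n := Real.log_pos (by exact_mod_cast h2n)
      have hs : 0 < √(lam n * Real.log n) := Real.sqrt_pos.2 (by positivity)
      rw [div_le_iff₀ hs, mul_assoc, Real.mul_self_sqrt (by positivity)]
      have h3 : ∑ i : Fin (d + 1), z n i ^ 2 ≤ ((d : ℝ) + 1) * (3 * Real.log n) := by
        refine (Finset.sum_le_sum fun i _ => hn i).trans (le_of_eq ?_)
        simp
      have := mul_le_mul_of_nonneg_left h3 hl.le
      linarith
  have h4 := h1.sub (he.mul_const y)
  simp only [zero_mul, sub_zero] at h4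
  refine h4.congr fun n => ?_
  ring

theorem chiSquare_sub_eq_mul (d : ℕ) {n : ℕ} (hn : 2 ≤ n) (hlam : 0 < lam n) (he : 0 ≤ e n)
    {y : ℝ} (hy : 0 ≤ y) :
    chiSquare d (lam n) (e n * y) (z n) - y
      = (z n 0 / √(Real.log n) * √(2 * y * e n)
          + (lam n * (∑ i : Fin (d + 1), z n i ^ 2) / 2 - (1 - e n) * y)
            / √(lam n * Real.log n)) * √(lam n * Real.log n) := by
  have hlog : 0 < Real.log n := Real.log_pos (by exact_mod_cast hn)
  have hs : 0 < √(lam n * Real.log n) := Real.sqrt_pos.2 (by positivity)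
  have hs' : 0 < √(Real.log n) := Real.sqrt_pos.2 hlog
  rw [chiSquare_sub d hlam.le he hy, add_mul, div_mul_cancel₀ _ hs.ne',
    Real.sqrt_mul hlam.le]
  field_simp

/-- Pathwise oscillation of scaled noncentral chi-square variables around their limit. -/
theorem chiSquare_oscillation (d : ℕ) (hlam : ∀ n, 2 ≤ n → 0 < lam n)
    (hlim : Tendsto (fun n : ℕ => lam n * Real.log n) atTop (𝓝 0))
    (he : Tendsto (fun n : ℕ => (1 - e n) / √(lam n * Real.log n)) atTop (𝓝 0))
    (he0 : ∀ᶠ n in atTop, 0 ≤ e n)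
    (hz : ∀ i, ∀ᶠ n : ℕ in atTop, z n i ^ 2 ≤ 3 * Real.log n)
    (hup : ∀ m : ℕ, ∀ᶠ n : ℕ in atTop, z n 0 ^ 2 ≤ (2 + 1 / ((m : ℝ) + 1)) * Real.log n)
    (hlow : ∀ m : ℕ, ∃ᶠ n : ℕ in atTop, √((2 - 1 / ((m : ℝ) + 1)) * Real.log n) ≤ z n 0)
    (hlow' : ∀ m : ℕ, ∃ᶠ n : ℕ in atTop, z n 0 ≤ -√((2 - 1 / ((m : ℝ) + 1)) * Real.log n))
    {y : ℝ} (hy : 0 ≤ y) {ε : ℝ} (hε : 0 < ε) :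
    (∀ᶠ n : ℕ in atTop, |chiSquare d (lam n) (e n * y) (z n) - y|
        ≤ (2 * √y + ε) * √(lam n * Real.log n)) ∧
    (∃ᶠ n : ℕ in atTop, (2 * √y - ε) * √(lam n * Real.log n)
        ≤ chiSquare d (lam n) (e n * y) (z n) - y) ∧
    (∃ᶠ n : ℕ in atTop, chiSquare d (lam n) (e n * y) (z n) - y
        ≤ -((2 * √y - ε) * √(lam n * Real.log n))) := by
  have hR := tendsto_chiSquare_remainder d hlam hlim he hz y
  set R : ℕ → ℝ := fun n => (lam n * (∑ i : Fin (d + 1), z n i ^ 2) / 2 - (1 - e n) * y)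
      / √(lam n * Real.log n) with hR_def
  have he1 : Tendsto e atTop (𝓝 1) := by
    have h1 := (he.mul hlim.sqrt).const_sub 1
    simp only [zero_mul, sub_zero] at h1
    refine h1.congr' ?_
    filter_upwards [eventually_ge_atTop 2] with n hn
    have hlog : 0 < Real.log n := Real.log_pos (by exact_mod_cast hn)
    have hs : 0 < √(lam n * Real.log n) := Real.sqrt_pos.2 (mul_pos (hlam n hn) hlog)
    rw [div_mul_cancel₀ _ hs.ne']
    ring
  have hsq : Tendsto (fun n => √(2 * y * e n)) atTop (𝓝 (√(2 * y))) := by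
    have := (he1.const_mul (2 * y)).sqrt
    rwa [mul_one] at this
  -- The first factor is the growth constant of normal sequences, the second the limiting
  -- coefficient of `z n 0`.
  have hprod : √2 * √(2 * y) = 2 * √y := by
    rw [← Real.sqrt_mul (by norm_num), ← mul_assoc, Real.sqrt_mul (by norm_num),
      Real.sqrt_mul_self (by norm_num)]
  have hm : Tendsto (fun m : ℕ => 1 / ((m : ℝ) + 1)) atTop (𝓝 0) :=
    tendsto_one_div_add_atTop_nhds_zero_nat
  have key : ∀ᶠ n : ℕ in atTop, chiSquare d (lam n) (e n * y) (z n) - y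
      = (z n 0 / √(Real.log n) * √(2 * y * e n) + R n) * √(lam n * Real.log n) := by
    filter_upwards [eventually_ge_atTop 2, he0] with n hn hen
    exact chiSquare_sub_eq_mul d hn (hlam n hn) hen hy
  have hlow_exists : ∃ m : ℕ, 2 * √y - ε < √(2 - 1 / ((m : ℝ) + 1)) * √(2 * y) := by
    have h1 := (hm.const_sub 2).sqrt.mul_const (√(2 * y))
    rw [sub_zero, hprod] at h1
    exact (h1.eventually (lt_mem_nhds (show 2 * √y - ε < 2 * √y by linarith))).exists
  refine ⟨?_, ?_, ?_⟩
  · obtain ⟨m, hm⟩ : ∃ m : ℕ, √(2 + 1 / ((m : ℝ) + 1)) * √(2 * y) < 2 * √y + ε := by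
      have h1 := (hm.const_add 2).sqrt.mul_const (√(2 * y))
      rw [add_zero, hprod] at h1
      exact (h1.eventually (gt_mem_nhds (show 2 * √y < 2 * √y + ε by linarith))).exists
    have h2 := (hsq.const_mul (√(2 + 1 / ((m : ℝ) + 1)))).add hR.abs
    rw [abs_zero, add_zero] at h2
    filter_upwards [key, h2.eventually (gt_mem_nhds hm), hup m, eventually_ge_atTop 2]
      with n h3 h4 h5 hn
    have hlog : 0 < Real.log n := Real.log_pos (by exact_mod_cast hn)
    have hs' : 0 < √(Real.log n) := Real.sqrt_pos.2 hlog
    rw [h3, abs_mul, abs_of_nonneg (Real.sqrt_nonneg (lam n * Real.log n))]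
    refine mul_le_mul_of_nonneg_right ?_ (Real.sqrt_nonneg _)
    refine (abs_add_le _ _).trans (le_trans ?_ h4.le)
    rw [abs_mul, abs_of_nonneg (Real.sqrt_nonneg (2 * y * e n))]
    have h6 : |z n 0 / √(Real.log n)| ≤ √(2 + 1 / ((m : ℝ) + 1)) := by
      rw [abs_div, abs_of_pos hs', div_le_iff₀ hs', ← Real.sqrt_mul (by positivity)]
      exact Real.abs_le_sqrt h5
    gcongr
  · obtain ⟨m, hm⟩ := hlow_exists
    have h2 := (hsq.const_mul (√(2 - 1 / ((m : ℝ) + 1)))).add hR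
    rw [add_zero] at h2
    refine ((hlow m).and_eventually (key.and ((h2.eventually (lt_mem_nhds hm)).and
      (eventually_ge_atTop 2)))).mono ?_
    rintro n ⟨h5, h3, h4, hn⟩
    have hlog : 0 < Real.log n := Real.log_pos (by exact_mod_cast hn)
    have hs' : 0 < √(Real.log n) := Real.sqrt_pos.2 hlog
    rw [h3]
    refine mul_le_mul_of_nonneg_right (h4.le.trans ?_) (Real.sqrt_nonneg _)
    have h6 : √(2 - 1 / ((m : ℝ) + 1)) ≤ z n 0 / √(Real.log n) := by
      rw [le_div_iff₀ hs', ← Real.sqrt_mul' _ hlog.le]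
      exact h5
    gcongr
  · obtain ⟨m, hm⟩ := hlow_exists
    have h2 := (hsq.const_mul (√(2 - 1 / ((m : ℝ) + 1)))).sub hR
    rw [sub_zero] at h2
    refine ((hlow' m).and_eventually (key.and ((h2.eventually (lt_mem_nhds hm)).and
      (eventually_ge_atTop 2)))).mono ?_
    rintro n ⟨h5, h3, h4, hn⟩
    have hlog : 0 < Real.log n := Real.log_pos (by exact_mod_cast hn)
    have hs' : 0 < √(Real.log n) := Real.sqrt_pos.2 hlog
    rw [h3, ← neg_mul]
    refine mul_le_mul_of_nonneg_right ?_ (Real.sqrt_nonneg _)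
    have h6 : √(2 - 1 / ((m : ℝ) + 1)) ≤ -(z n 0 / √(Real.log n)) := by
      rw [← neg_div, le_div_iff₀ hs', ← Real.sqrt_mul' _ hlog.le]
      linarith
    have h7 := mul_le_mul_of_nonneg_right h6 (Real.sqrt_nonneg (2 * y * e n))
    linarith

end Deterministic

/-- Almost sure oscillation of the minorant process. -/
theorem ae_minorant_oscillation (d : ℕ) {lam e : ℕ → ℝ} {α c : ℝ} (hα : 0 < α) (hc : 0 < c)
    (hlam : ∀ n, 2 ≤ n → 0 < lam n)
    (hlim : Tendsto (fun n : ℕ => lam n * Real.log n) atTop (𝓝 0))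
    (he : Tendsto (fun n : ℕ => (1 - e n) / √(lam n * Real.log n)) atTop (𝓝 0))
    (he0 : ∀ᶠ n in atTop, 0 ≤ e n) :
    ∀ᵐ ω ∂gammaGaussianMeasure α c, 0 ≤ ω.1 ∧ ∀ ε : ℝ, 0 < ε →
      (∀ᶠ n : ℕ in atTop, |chiSquare d (lam n) (e n * ω.1) (fun i => ω.2 (n, i)) - ω.1|
        ≤ (2 * √ω.1 + ε) * √(lam n * Real.log n)) ∧
      (∃ᶠ n : ℕ in atTop, (2 * √ω.1 - ε) * √(lam n * Real.log n)
        ≤ chiSquare d (lam n) (e n * ω.1) (fun i => ω.2 (n, i)) - ω.1) ∧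
      (∃ᶠ n : ℕ in atTop, chiSquare d (lam n) (e n * ω.1) (fun i => ω.2 (n, i)) - ω.1
        ≤ -((2 * √ω.1 - ε) * √(lam n * Real.log n))) := by
  have := isProbabilityMeasure_gammaMeasure hα hc
  have hW : ∀ i n, Measurable fun z : ℕ × ℕ → ℝ => z (n, i) := fun i n =>
    measurable_pi_apply _
  have hlaw : ∀ i n, (Measure.infinitePi fun _ : ℕ × ℕ => gaussianReal 0 1).map
      (fun z : ℕ × ℕ → ℝ => z (n, i)) = gaussianReal 0 1 := fun i n =>
    Measure.infinitePi_map_eval (fun _ : ℕ × ℕ => gaussianReal 0 1) (n, i)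
  have hind : iIndepFun (fun (n : ℕ) (z : ℕ × ℕ → ℝ) => z (n, 0))
      (Measure.infinitePi fun _ : ℕ × ℕ => gaussianReal 0 1) := by
    have h0 : iIndepFun (fun (i : ℕ × ℕ) (z : ℕ × ℕ → ℝ) => z i)
        (Measure.infinitePi fun _ : ℕ × ℕ => gaussianReal 0 1) :=
      iIndepFun_infinitePi (X := fun _ x => x) fun _ => measurable_id
    exact h0.precomp (g := fun n : ℕ => (n, 0)) fun a b hab => (Prod.mk.inj hab).1
  have h1 : ∀ᵐ z ∂(Measure.infinitePi fun _ : ℕ × ℕ => gaussianReal 0 1),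
      ∀ i, ∀ᶠ n : ℕ in atTop, z (n, i) ^ 2 ≤ 3 * Real.log n :=
    ae_all_iff.2 fun i => ae_eventually_sq_le_log (hW i) (hlaw i) (by norm_num)
  have h2 : ∀ᵐ z ∂(Measure.infinitePi fun _ : ℕ × ℕ => gaussianReal 0 1),
      ∀ m : ℕ, ∀ᶠ n : ℕ in atTop, z (n, 0) ^ 2 ≤ (2 + 1 / ((m : ℝ) + 1)) * Real.log n :=
    ae_all_iff.2 fun m => ae_eventually_sq_le_log (hW 0) (hlaw 0) (by
      have : (0 : ℝ) < 1 / ((m : ℝ) + 1) := by positivity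
      linarith)
  have hm0 : ∀ m : ℕ, (0 : ℝ) ≤ 2 - 1 / ((m : ℝ) + 1) := fun m => by
    have : 1 / ((m : ℝ) + 1) ≤ 1 := by
      rw [div_le_one (by positivity)]
      have : (0 : ℝ) ≤ m := m.cast_nonneg
      linarith
    linarith
  have hm2 : ∀ m : ℕ, 2 - 1 / ((m : ℝ) + 1) < 2 := fun m => by
    have : (0 : ℝ) < 1 / ((m : ℝ) + 1) := by positivity
    linarith
  have h3 : ∀ᵐ z ∂(Measure.infinitePi fun _ : ℕ × ℕ => gaussianReal 0 1),
      ∀ m : ℕ, ∃ᶠ n : ℕ in atTop, √((2 - 1 / ((m : ℝ) + 1)) * Real.log n) ≤ z (n, 0) :=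
    ae_all_iff.2 fun m => ae_frequently_sqrt_log_le (hW 0) hind (hlaw 0) (hm0 m) (hm2 m)
  have h4 : ∀ᵐ z ∂(Measure.infinitePi fun _ : ℕ × ℕ => gaussianReal 0 1),
      ∀ m : ℕ, ∃ᶠ n : ℕ in atTop, z (n, 0) ≤ -√((2 - 1 / ((m : ℝ) + 1)) * Real.log n) :=
    ae_all_iff.2 fun m => ae_frequently_le_neg_sqrt_log (hW 0) hind (hlaw 0) (hm0 m) (hm2 m)
  have hfst : Measure.QuasiMeasurePreserving Prod.fst (gammaGaussianMeasure α c)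
      (gammaMeasure α c) := Measure.quasiMeasurePreserving_fst
  have hsnd : Measure.QuasiMeasurePreserving Prod.snd (gammaGaussianMeasure α c)
      (Measure.infinitePi fun _ : ℕ × ℕ => gaussianReal 0 1) := Measure.quasiMeasurePreserving_snd
  filter_upwards [hfst.ae (ae_nonneg_gammaMeasure α c), hsnd.ae h1, hsnd.ae h2, hsnd.ae h3,
    hsnd.ae h4] with ω hy i1 i2 i3 i4
  exact ⟨hy, fun ε hε => chiSquare_oscillation (z := fun n i => ω.2 (n, i)) d hlam hlim he he0
    i1 i2 i3 i4 hy hε⟩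

/-! ### Upper and lower limits, and the transfer from the minorants to the process -/

theorem limsup_eq_of_forall_eps {u : ℕ → ℝ} {L : ℝ}
    (h1 : ∀ ε : ℝ, 0 < ε → ∀ᶠ n in atTop, u n ≤ L + ε)
    (h2 : ∀ ε : ℝ, 0 < ε → ∃ᶠ n in atTop, L - ε ≤ u n) :
    limsup (fun n => (u n : EReal)) atTop = (L : EReal) := by
  refine le_antisymm (EReal.le_of_forall_lt_iff_le.1 fun z hz => ?_)
    (EReal.ge_of_forall_gt_iff_ge.1 fun z hz => ?_)
  · refine limsup_le_of_le (by isBoundedDefault) ?_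
    filter_upwards [h1 (z - L) (sub_pos.2 (EReal.coe_lt_coe_iff.1 hz))] with n hn
    exact EReal.coe_le_coe_iff.2 (by linarith)
  · refine le_limsup_of_frequently_le ?_ (by isBoundedDefault)
    refine (h2 (L - z) (sub_pos.2 (EReal.coe_lt_coe_iff.1 hz))).mono fun n hn => ?_
    exact EReal.coe_le_coe_iff.2 (by linarith)

theorem liminf_eq_of_forall_eps {u : ℕ → ℝ} {L : ℝ}
    (h1 : ∀ ε : ℝ, 0 < ε → ∀ᶠ n in atTop, L - ε ≤ u n)
    (h2 : ∀ ε : ℝ, 0 < ε → ∃ᶠ n in atTop, u n ≤ L + ε) :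
    liminf (fun n => (u n : EReal)) atTop = (L : EReal) := by
  refine le_antisymm (EReal.le_of_forall_lt_iff_le.1 fun z hz => ?_)
    (EReal.ge_of_forall_gt_iff_ge.1 fun z hz => ?_)
  · refine liminf_le_of_frequently_le ?_ (by isBoundedDefault)
    refine (h2 (z - L) (sub_pos.2 (EReal.coe_lt_coe_iff.1 hz))).mono fun n hn => ?_
    exact EReal.coe_le_coe_iff.2 (by linarith)
  · refine le_liminf_of_le (by isBoundedDefault) ?_
    filter_upwards [h1 (L - z) (sub_pos.2 (EReal.coe_lt_coe_iff.1 hz))] with n hn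
    exact EReal.coe_le_coe_iff.2 (by linarith)

/-- The value at the label `j` of the minorant process which starts at the index `n`, paired with
its value at the label `0`. -/
noncomputable def minorantPair (d : ℕ) (lam f g : ℕ → ℝ) (n j : ℕ) (ω : ℝ × (ℕ × ℕ → ℝ)) : ℝ × ℝ :=
  (ω.1, chiSquare d (lam j) (tailFactor lam f g n j * ω.1) fun i => ω.2 (j, i))

theorem coe_minorantVector {d : ℕ} {lam f g : ℕ → ℝ} {n M : ℕ} {ω : ℝ × (ℕ × ℕ → ℝ)}
    (hω : 0 ≤ ω.1) (j : Fin M) :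
    ((minorantVector d lam (tailFactor lam f g n) n M ω 0 : ℝ),
      (minorantVector d lam (tailFactor lam f g n) n M ω j.succ : ℝ))
      = minorantPair d lam f g n (n + j) ω := by
  simp only [minorantVector, Fin.cons_zero, Fin.cons_succ, minorantPair, Real.coe_toNNReal _ hω,
    Real.coe_toNNReal _ (chiSquare_nonneg _ _ _ _)]

theorem ae_nonneg_fst_gammaGaussianMeasure {α c : ℝ} :
    ∀ᵐ ω ∂gammaGaussianMeasure α c, 0 ≤ ω.1 := by
  have hfst : Measure.QuasiMeasurePreserving Prod.fst (gammaGaussianMeasure α c)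
      (gammaMeasure α c) := Measure.quasiMeasurePreserving_fst
  exact hfst.ae (ae_nonneg_gammaMeasure α c)

theorem measurableSet_pair {lam f g : ℕ → ℝ} {Ω : Type*} [MeasurableSpace Ω] {P : Measure Ω}
    {d : ℕ} {X : T → Ω → ℝ}
    (hX : IsPermanentalProcess P (((d + 1 : ℕ) : ℝ) / 2) (U lam f g) X)
    {B : ℕ → Set (ℝ × ℝ)} (hB : ∀ j, MeasurableSet (B j)) (j : ℕ) :
    MeasurableSet {ω | (X zeroPt ω, X (invPt j) ω) ∈ B j} := by
  have hm : ∀ t, Measurable (X t) := fun t => (hX 1 fun _ => t).measurable 0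
  exact ((hm zeroPt).prodMk (hm (invPt j))) (hB j)

namespace Admissible

variable {lam f g : ℕ → ℝ} {Ω : Type*} [MeasurableSpace Ω] {P : Measure Ω}
  [IsProbabilityMeasure P] {d : ℕ} {X : T → Ω → ℝ}

/-- The law comparison holds on windows of consecutive labels. This form extracts events at a finite
set of labels, stated on pairs of real values, from which infinite intersections are reached by
monotone limits. -/
theorem minorant_le_forall (h : Admissible lam f g)
    (hX : IsPermanentalProcess P (((d + 1 : ℕ) : ℝ) / 2) (U lam f g) X)
    {B : ℕ → Set (ℝ × ℝ)} (hB : ∀ j, MeasurableSet (B j)) {n : ℕ} (hn : 2 ≤ n) (J : Finset ℕ)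
    (hJ : ∀ j ∈ J, n ≤ j) :
    ENNReal.ofReal (tailMass lam f g (((d + 1 : ℕ) : ℝ) / 2) n) *
        gammaGaussianMeasure (((d + 1 : ℕ) : ℝ) / 2) (tailRate lam f g n)
          {ω | ∀ j ∈ J, minorantPair d lam f g n j ω ∈ B j}
      ≤ P {ω | ∀ j ∈ J, (X zeroPt ω, X (invPt j) ω) ∈ B j} := by
  -- Long enough that every `j ∈ J` has the form `n + i` with `i < M`.
  let M := J.sup id + 1
  let A : Set (Fin (M + 1) → ℝ≥0) :=
    {v | ∀ j : Fin M, n + (j : ℕ) ∈ J → ((v 0 : ℝ), (v j.succ : ℝ)) ∈ B (n + j)}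
  have hA : MeasurableSet A := by
    have : A = ⋂ j : Fin M, ⋂ _ : n + (j : ℕ) ∈ J,
        (fun v : Fin (M + 1) → ℝ≥0 => ((v 0 : ℝ), (v j.succ : ℝ))) ⁻¹' B (n + j) := by
      ext v
      simp [A]
    rw [this]
    exact MeasurableSet.iInter fun j => MeasurableSet.iInter fun _ =>
      (by fun_prop : Measurable fun v : Fin (M + 1) → ℝ≥0 =>
        ((v 0 : ℝ), (v j.succ : ℝ))) (hB _)
  have hnonneg : ∀ t ω, 0 ≤ X t ω := fun t ω => (hX 1 fun _ => t).nonneg 0 ω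
  refine le_trans (mul_le_mul_right (measure_mono_ae ?_) _)
    ((h.minorant_le hX hn M hA).trans (measure_mono ?_))
  · filter_upwards [ae_nonneg_fst_gammaGaussianMeasure] with ω hω hall j hj
    rw [coe_minorantVector hω]
    exact hall _ hj
  · intro ω hω j hj
    have hjM : j - n < M := by
      have : j ≤ J.sup id := Finset.le_sup (f := id) hj
      omega
    have hnj : n + (j - n) = j := by have := hJ j hj; omega
    have := hω ⟨j - n, hjM⟩ (by simpa only [hnj] using hj)
    simpa only [tailPt, Fin.cons_zero, Fin.cons_succ, Real.coe_toNNReal _ (hnonneg _ _), hnj]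
      using this

theorem minorant_le_exists (h : Admissible lam f g)
    (hX : IsPermanentalProcess P (((d + 1 : ℕ) : ℝ) / 2) (U lam f g) X)
    {B : ℕ → Set (ℝ × ℝ)} (hB : ∀ j, MeasurableSet (B j)) {n : ℕ} (hn : 2 ≤ n) (J : Finset ℕ)
    (hJ : ∀ j ∈ J, n ≤ j) :
    ENNReal.ofReal (tailMass lam f g (((d + 1 : ℕ) : ℝ) / 2) n) *
        gammaGaussianMeasure (((d + 1 : ℕ) : ℝ) / 2) (tailRate lam f g n)
          {ω | ∃ j ∈ J, minorantPair d lam f g n j ω ∈ B j}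
      ≤ P {ω | ∃ j ∈ J, (X zeroPt ω, X (invPt j) ω) ∈ B j} := by
  let M := J.sup id + 1
  let A : Set (Fin (M + 1) → ℝ≥0) :=
    {v | ∃ j : Fin M, n + (j : ℕ) ∈ J ∧ ((v 0 : ℝ), (v j.succ : ℝ)) ∈ B (n + j)}
  have hA : MeasurableSet A := by
    have : A = ⋃ j : Fin M, ⋃ _ : n + (j : ℕ) ∈ J,
        (fun v : Fin (M + 1) → ℝ≥0 => ((v 0 : ℝ), (v j.succ : ℝ))) ⁻¹' B (n + j) := by
      ext v
      simp [A]
    rw [this]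
    exact MeasurableSet.iUnion fun j => MeasurableSet.iUnion fun _ =>
      (by fun_prop : Measurable fun v : Fin (M + 1) → ℝ≥0 =>
        ((v 0 : ℝ), (v j.succ : ℝ))) (hB _)
  have hnonneg : ∀ t ω, 0 ≤ X t ω := fun t ω => (hX 1 fun _ => t).nonneg 0 ω
  refine le_trans (mul_le_mul_right (measure_mono_ae ?_) _)
    ((h.minorant_le hX hn M hA).trans (measure_mono ?_))
  · filter_upwards [ae_nonneg_fst_gammaGaussianMeasure] with ω hω
    rintro ⟨j, hj, hjB⟩
    have hjM : j - n < M := by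
      have : j ≤ J.sup id := Finset.le_sup (f := id) hj
      omega
    have hnj : n + (j - n) = j := by have := hJ j hj; omega
    refine ⟨⟨j - n, hjM⟩, by simpa only [hnj] using hj, ?_⟩
    rw [coe_minorantVector hω]
    simpa only [hnj] using hjB
  · rintro ω ⟨j, hj, hjB⟩
    refine ⟨n + j, hj, ?_⟩
    simpa only [tailPt, Fin.cons_zero, Fin.cons_succ, Real.coe_toNNReal _ (hnonneg _ _)]
      using hjB

theorem isProbabilityMeasure_tail (h : Admissible lam f g) (d : ℕ) {n : ℕ} (hn : 2 ≤ n) :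
    IsProbabilityMeasure
      (gammaGaussianMeasure (((d + 1 : ℕ) : ℝ) / 2) (tailRate lam f g n)) := by
  have := isProbabilityMeasure_gammaMeasure (a := ((d + 1 : ℕ) : ℝ) / 2) (by positivity)
    (h.tailRate_pos hn)
  unfold gammaGaussianMeasure
  infer_instance

/-- The starting index of the minorant is free and the masses tend to `1`, so a bound by all late
masses is a bound by `1`. -/
theorem one_le_of_forall_tailMass_le {α : ℝ} {x : ℝ≥0∞} {N : ℕ}
    (hx : ∀ n, N ≤ n → ENNReal.ofReal (tailMass lam f g α n) ≤ x) : 1 ≤ x := by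
  have h1 := ENNReal.tendsto_ofReal (tendsto_tailMass lam f g α)
  rw [ENNReal.ofReal_one] at h1
  exact le_of_tendsto h1 (eventually_atTop.2 ⟨N, hx⟩)

/-- A property which holds eventually for all minorant processes holds eventually for the
permanental process. -/
theorem ae_eventually_of_minorant (h : Admissible lam f g)
    (hX : IsPermanentalProcess P (((d + 1 : ℕ) : ℝ) / 2) (U lam f g) X)
    {B : ℕ → Set (ℝ × ℝ)} (hB : ∀ j, MeasurableSet (B j))
    (hmin : ∀ n, 2 ≤ n → ∀ᵐ ω ∂gammaGaussianMeasure (((d + 1 : ℕ) : ℝ) / 2) (tailRate lam f g n),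
      ∀ᶠ j in atTop, minorantPair d lam f g n j ω ∈ B j) :
    ∀ᵐ ω ∂P, ∀ᶠ j in atTop, (X zeroPt ω, X (invPt j) ω) ∈ B j := by
  have hS := measurableSet_pair hX hB
  have hmeas : MeasurableSet {ω | ∀ᶠ j in atTop, (X zeroPt ω, X (invPt j) ω) ∈ B j} := by
    have : {ω | ∀ᶠ j in atTop, (X zeroPt ω, X (invPt j) ω) ∈ B j}
        = ⋃ N : ℕ, ⋂ j : ℕ, ⋂ _ : N ≤ j, {ω | (X zeroPt ω, X (invPt j) ω) ∈ B j} := by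
      ext ω
      simp [eventually_atTop]
    rw [this]
    exact MeasurableSet.iUnion fun N => MeasurableSet.iInter fun j => MeasurableSet.iInter
      fun _ => hS j
  change {ω | ∀ᶠ j in atTop, (X zeroPt ω, X (invPt j) ω) ∈ B j} ∈ ae P
  rw [mem_ae_iff_prob_eq_one hmeas]
  refine le_antisymm prob_le_one (one_le_of_forall_tailMass_le (N := 2) (lam := lam) (f := f)
    (g := g) (α := ((d + 1 : ℕ) : ℝ) / 2) fun n hn => ?_)
  have := h.isProbabilityMeasure_tail d hn
  set μ := gammaGaussianMeasure (((d + 1 : ℕ) : ℝ) / 2) (tailRate lam f g n)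
  -- Here `n` is fixed: finite windows `[N, K)` decrease to the event on `[N, ∞)` as `K` grows.
  -- Afterwards `N` grows, and the minorant probabilities increase to `1`.
  have hN : ∀ N, n ≤ N → ENNReal.ofReal (tailMass lam f g (((d + 1 : ℕ) : ℝ) / 2) n) *
      μ {ω | ∀ j, N ≤ j → minorantPair d lam f g n j ω ∈ B j}
      ≤ P {ω | ∀ j, N ≤ j → (X zeroPt ω, X (invPt j) ω) ∈ B j} := by
    intro N hnN
    let C : ℕ → Set Ω := fun K => {ω | ∀ j ∈ Finset.Ico N K, (X zeroPt ω, X (invPt j) ω) ∈ B j}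
    have hC : {ω | ∀ j, N ≤ j → (X zeroPt ω, X (invPt j) ω) ∈ B j} = ⋂ K, C K := by
      ext ω
      simp only [C, Set.mem_iInter, Set.mem_ofPred_eq, Finset.mem_Ico]
      exact ⟨fun hω K j hj => hω j hj.1, fun hω j hj => hω (j + 1) j ⟨hj, j.lt_succ_self⟩⟩
    have hanti : Antitone C := fun K K' hK ω hω j hj =>
      hω j (Finset.Ico_subset_Ico_right hK hj)
    have hCm : ∀ K, MeasurableSet (C K) := fun K => by
      have : C K = ⋂ j : ℕ, ⋂ _ : j ∈ Finset.Ico N K,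
          {ω | (X zeroPt ω, X (invPt j) ω) ∈ B j} := by
        ext ω
        simp [C]
      rw [this]
      exact MeasurableSet.iInter fun j => MeasurableSet.iInter fun _ => hS j
    rw [hC, hanti.measure_iInter (fun K => (hCm K).nullMeasurableSet) ⟨0, measure_ne_top _ _⟩]
    refine le_iInf fun K => le_trans (mul_le_mul_right (measure_mono ?_) _)
      (h.minorant_le_forall hX hB hn (Finset.Ico N K) fun j hj =>
        hnN.trans (Finset.mem_Ico.1 hj).1)
    exact fun ω hω j hj => hω j (Finset.mem_Ico.1 hj).1
  let D : ℕ → Set (ℝ × (ℕ × ℕ → ℝ)) := fun N =>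
    {ω | ∀ j, n + N ≤ j → minorantPair d lam f g n j ω ∈ B j}
  have hmono : Monotone D := fun N N' hNN ω hω j hj => hω j (by omega)
  have hD : μ (⋃ N, D N) = 1 := by
    refine (measure_congr (eventuallyEq_univ.2 ?_)).trans measure_univ
    filter_upwards [hmin n hn] with ω hω
    obtain ⟨N, hN⟩ := eventually_atTop.1 hω
    exact Set.mem_iUnion.2 ⟨N, fun j hj => hN j (by omega)⟩
  have hlimD := hmono.measure_iUnion (μ := μ)
  rw [← mul_one (ENNReal.ofReal _), ← hD, hlimD, ENNReal.mul_iSup]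
  refine iSup_le fun N => (hN (n + N) (Nat.le_add_right _ _)).trans (measure_mono ?_)
  exact fun ω hω => eventually_atTop.2 ⟨_, hω⟩

/-- A property which holds infinitely often for all minorant processes holds infinitely often for
the permanental process. -/
theorem ae_frequently_of_minorant (h : Admissible lam f g)
    (hX : IsPermanentalProcess P (((d + 1 : ℕ) : ℝ) / 2) (U lam f g) X)
    {B : ℕ → Set (ℝ × ℝ)} (hB : ∀ j, MeasurableSet (B j))
    (hmin : ∀ n, 2 ≤ n → ∀ᵐ ω ∂gammaGaussianMeasure (((d + 1 : ℕ) : ℝ) / 2) (tailRate lam f g n),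
      ∃ᶠ j in atTop, minorantPair d lam f g n j ω ∈ B j) :
    ∀ᵐ ω ∂P, ∃ᶠ j in atTop, (X zeroPt ω, X (invPt j) ω) ∈ B j := by
  have hS := measurableSet_pair hX hB
  have hall : ∀ N : ℕ, ∀ᵐ ω ∂P, ∃ j, N ≤ j ∧ (X zeroPt ω, X (invPt j) ω) ∈ B j := by
    intro N
    have hmeas : MeasurableSet {ω | ∃ j, N ≤ j ∧ (X zeroPt ω, X (invPt j) ω) ∈ B j} := by
      have : {ω | ∃ j, N ≤ j ∧ (X zeroPt ω, X (invPt j) ω) ∈ B j}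
          = ⋃ j : ℕ, ⋃ _ : N ≤ j, {ω | (X zeroPt ω, X (invPt j) ω) ∈ B j} := by
        ext ω
        simp
      rw [this]
      exact MeasurableSet.iUnion fun j => MeasurableSet.iUnion fun _ => hS j
    change {ω | ∃ j, N ≤ j ∧ (X zeroPt ω, X (invPt j) ω) ∈ B j} ∈ ae P
    rw [mem_ae_iff_prob_eq_one hmeas]
    -- Starting the minorant at `n ≥ N` makes any success at a label `j ≥ n` count as a success
    -- beyond `N`.
    refine le_antisymm prob_le_one (one_le_of_forall_tailMass_le (N := max N 2) (lam := lam)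
      (f := f) (g := g) (α := ((d + 1 : ℕ) : ℝ) / 2) fun n hn => ?_)
    have hn2 : 2 ≤ n := (le_max_right _ _).trans hn
    have hNn : N ≤ n := (le_max_left _ _).trans hn
    have := h.isProbabilityMeasure_tail d hn2
    set μ := gammaGaussianMeasure (((d + 1 : ℕ) : ℝ) / 2) (tailRate lam f g n)
    let D : ℕ → Set (ℝ × (ℕ × ℕ → ℝ)) := fun K =>
      {ω | ∃ j ∈ Finset.Ico n K, minorantPair d lam f g n j ω ∈ B j}
    have hmono : Monotone D := fun K K' hK ω ⟨j, hj, hjB⟩ =>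
      ⟨j, Finset.Ico_subset_Ico_right hK hj, hjB⟩
    have hD : μ (⋃ K, D K) = 1 := by
      refine (measure_congr (eventuallyEq_univ.2 ?_)).trans measure_univ
      filter_upwards [hmin n hn2] with ω hω
      obtain ⟨j, hj, hjB⟩ := frequently_atTop.1 hω n
      exact Set.mem_iUnion.2 ⟨j + 1, j, Finset.mem_Ico.2 ⟨hj, j.lt_succ_self⟩, hjB⟩
    rw [← mul_one (ENNReal.ofReal _), ← hD, hmono.measure_iUnion, ENNReal.mul_iSup]
    refine iSup_le fun K => (h.minorant_le_exists hX hB hn2 (Finset.Ico n K) fun j hj =>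
        (Finset.mem_Ico.1 hj).1).trans (measure_mono ?_)
    rintro ω ⟨j, hj, hjB⟩
    exact ⟨j, hNn.trans (Finset.mem_Ico.1 hj).1, hjB⟩
  filter_upwards [ae_all_iff.2 hall] with ω hω
  exact frequently_atTop.2 hω

/-- For fixed `n`, `1 - e_j = a γ_j + b φ_j - a b φ_j γ_j`. Each of these sequences is `o(lam j)` by
summability, and `u_j / √(lam j * log j) = (u_j / lam j) * √(lam j * log j) / log j`. -/
theorem tendsto_one_sub_tailFactor_div (h : Admissible lam f g)
    (hlim : Tendsto (fun n : ℕ => lam n * Real.log n) atTop (𝓝 0)) (n : ℕ) :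
    Tendsto (fun j : ℕ => (1 - tailFactor lam f g n j) / √(lam j * Real.log j)) atTop (𝓝 0) := by
  have hlog : Tendsto (fun j : ℕ => (Real.log j)⁻¹) atTop (𝓝 0) :=
    tendsto_inv_atTop_zero.comp tendsto_log_natCast
  have hs : Tendsto (fun j : ℕ => √(lam j * Real.log j)) atTop (𝓝 0) := by
    simpa using hlim.sqrt
  have key : ∀ u : ℕ → ℝ, Summable (fun j : ℕ => u (j + 2) / lam (j + 2)) →
      Tendsto (fun j : ℕ => u j / √(lam j * Real.log j)) atTop (𝓝 0) := by
    intro u hu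
    have h1 : Tendsto (fun j => u j / lam j) atTop (𝓝 0) :=
      (tendsto_add_atTop_iff_nat 2).1 hu.tendsto_atTop_zero
    have h2 := h1.mul (hs.mul hlog)
    simp only [zero_mul] at h2
    refine h2.congr' ?_
    filter_upwards [eventually_ge_atTop 2] with j hj
    have hl := h.lam_pos j hj
    have hlog : 0 < Real.log j := Real.log_pos (by exact_mod_cast hj)
    have hsj : 0 < √(lam j * Real.log j) := Real.sqrt_pos.2 (by positivity)
    have hsq : √(lam j * Real.log j) ^ 2 = lam j * Real.log j := Real.sq_sqrt (by positivity)
    rw [eq_div_iff hsj.ne']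
    calc u j / lam j * (√(lam j * Real.log j) * (Real.log j)⁻¹) * √(lam j * Real.log j)
        = u j / lam j * (Real.log j)⁻¹ * √(lam j * Real.log j) ^ 2 := by ring
      _ = u j := by rw [hsq]; field_simp
  have hφ := key _ h.summable_f
  have hγ := key _ h.summable_g
  have hφγ := key _ h.summable_mul
  set a := (1 + weightedTail lam (deficit f) n) / (2 + weightedTail lam (deficitMul f g) n)
  set b := (1 + weightedTail lam (deficit g) n) / (2 + weightedTail lam (deficitMul f g) n)
  have h3 := ((hγ.const_mul a).add (hφ.const_mul b)).sub (hφγ.const_mul (a * b))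
  simp only [mul_zero, add_zero, sub_zero] at h3
  refine h3.congr fun j => ?_
  simp only [tailFactor, minorantFactor, deficitMul]
  ring

/-- Almost sure oscillation of the permanental process at `0`. -/
theorem ae_oscillation (h : Admissible lam f g)
    (hlim : Tendsto (fun n : ℕ => lam n * Real.log n) atTop (𝓝 0))
    (hX : IsPermanentalProcess P (((d + 1 : ℕ) : ℝ) / 2) (U lam f g) X) {ε : ℝ} (hε : 0 < ε) :
    ∀ᵐ ω ∂P,
      (∀ᶠ n : ℕ in atTop, |X (invPt n) ω - X zeroPt ω|
        ≤ (2 * √(X zeroPt ω) + ε) * √(lam n * Real.log n)) ∧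
      (∃ᶠ n : ℕ in atTop, (2 * √(X zeroPt ω) - ε) * √(lam n * Real.log n)
        ≤ X (invPt n) ω - X zeroPt ω) ∧
      (∃ᶠ n : ℕ in atTop, X (invPt n) ω - X zeroPt ω
        ≤ -((2 * √(X zeroPt ω) - ε) * √(lam n * Real.log n))) := by
  have hmin : ∀ n, 2 ≤ n → _ := fun n hn =>
    ae_minorant_oscillation d (α := ((d + 1 : ℕ) : ℝ) / 2) (by positivity) (h.tailRate_pos hn)
      h.lam_pos hlim (h.tendsto_one_sub_tailFactor_div hlim n)
      ((eventually_ge_atTop 2).mono fun _ hj => h.tailFactor_nonneg hn hj)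
  filter_upwards [
    h.ae_eventually_of_minorant hX
      (B := fun j => {x | |x.2 - x.1| ≤ (2 * √x.1 + ε) * √(lam j * Real.log j)})
      (fun j => measurableSet_le (by fun_prop) (by fun_prop))
      (fun n hn => (hmin n hn).mono fun ω hω => (hω.2 ε hε).1),
    h.ae_frequently_of_minorant hX
      (B := fun j => {x | (2 * √x.1 - ε) * √(lam j * Real.log j) ≤ x.2 - x.1})
      (fun j => measurableSet_le (by fun_prop) (by fun_prop))
      (fun n hn => (hmin n hn).mono fun ω hω => (hω.2 ε hε).2.1),
    h.ae_frequently_of_minorant hX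
      (B := fun j => {x | x.2 - x.1 ≤ -((2 * √x.1 - ε) * √(lam j * Real.log j))})
      (fun j => measurableSet_le (by fun_prop) (by fun_prop))
      (fun n hn => (hmin n hn).mono fun ω hω => (hω.2 ε hε).2.2)] with ω h1 h2 h3
  exact ⟨h1, h2, h3⟩

/-- Almost sure oscillation of the normalized increments of the permanental process at `0`. -/
theorem ae_normalized_oscillation (h : Admissible lam f g)
    (hlim : Tendsto (fun n : ℕ => lam n * Real.log n) atTop (𝓝 0))
    (hX : IsPermanentalProcess P (((d + 1 : ℕ) : ℝ) / 2) (U lam f g) X) :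
    ∀ᵐ ω ∂P, ∀ ε : ℝ, 0 < ε →
      (∀ᶠ n : ℕ in atTop, |X (invPt n) ω - X zeroPt ω| / √(lam n * Real.log n)
        ≤ 2 * √(X zeroPt ω) + ε) ∧
      (∃ᶠ n : ℕ in atTop, 2 * √(X zeroPt ω) - ε
        ≤ (X (invPt n) ω - X zeroPt ω) / √(lam n * Real.log n)) ∧
      (∃ᶠ n : ℕ in atTop, (X (invPt n) ω - X zeroPt ω) / √(lam n * Real.log n)
        ≤ -(2 * √(X zeroPt ω)) + ε) := by
  have hpos : ∀ᶠ n : ℕ in atTop, 0 < √(lam n * Real.log n) := by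
    filter_upwards [eventually_ge_atTop 2] with n hn
    exact Real.sqrt_pos.2 (mul_pos (h.lam_pos n hn) (Real.log_pos (by exact_mod_cast hn)))
  -- Countably many `ε = 1 / (m + 1)` suffice to obtain one null set valid for all `ε`.
  filter_upwards [ae_all_iff.2 fun m : ℕ => h.ae_oscillation hlim hX
    (ε := 1 / ((m : ℝ) + 1)) (by positivity)] with ω hω ε hε
  obtain ⟨m, hm⟩ := exists_nat_one_div_lt hε
  obtain ⟨h1, h2, h3⟩ := hω m
  refine ⟨?_, ?_, ?_⟩
  · filter_upwards [h1, hpos] with n hn hs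
    have := (div_le_iff₀ hs).2 hn
    linarith
  · refine (h2.and_eventually hpos).mono fun n hn => ?_
    have := (le_div_iff₀ hn.2).2 hn.1
    linarith
  · refine (h3.and_eventually hpos).mono fun n hn => ?_
    have h4 := hn.1
    rw [← neg_mul] at h4
    have := (div_le_iff₀ hn.2).2 h4
    linarith

end Admissible

end KolmogorovPermanental

theorem theorem1p4 {Ω : Type*} [MeasurableSpace Ω] (P : MeasureTheory.Measure Ω)
    [MeasureTheory.IsProbabilityMeasure P] (lam f g : ℕ → ℝ)
    (hadm : KolmogorovPermanental.Admissible lam f g)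
    (hlim : Filter.Tendsto (fun n : ℕ => lam n * Real.log n) Filter.atTop (nhds 0))
    (k : ℕ) (hk : 1 ≤ k) (X : KolmogorovPermanental.T → Ω → ℝ)
    (hX : KolmogorovPermanental.IsPermanentalProcess P ((k : ℝ) / 2)
      (KolmogorovPermanental.U lam f g) X) :
    (∀ᵐ ω ∂P, Filter.limsup (fun n : ℕ =>
        ((|X (KolmogorovPermanental.invPt n) ω - X KolmogorovPermanental.zeroPt ω| /
          Real.sqrt (lam n * Real.log n) : ℝ) : EReal)) Filter.atTop
        = ((2 * Real.sqrt (X KolmogorovPermanental.zeroPt ω) : ℝ) : EReal)) ∧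
    (∀ᵐ ω ∂P, Filter.limsup (fun n : ℕ =>
        (((X (KolmogorovPermanental.invPt n) ω - X KolmogorovPermanental.zeroPt ω) /
          Real.sqrt (lam n * Real.log n) : ℝ) : EReal)) Filter.atTop
        = ((2 * Real.sqrt (X KolmogorovPermanental.zeroPt ω) : ℝ) : EReal)) ∧
    (∀ᵐ ω ∂P, Filter.liminf (fun n : ℕ =>
        (((X (KolmogorovPermanental.invPt n) ω - X KolmogorovPermanental.zeroPt ω) /
          Real.sqrt (lam n * Real.log n) : ℝ) : EReal)) Filter.atTop
        = ((-(2 * Real.sqrt (X KolmogorovPermanental.zeroPt ω)) : ℝ) : EReal)) := by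
  -- At least one degree of freedom is needed, to carry the noncentrality.
  obtain ⟨d, rfl⟩ : ∃ d, k = d + 1 := ⟨k - 1, by omega⟩
  have key := hadm.ae_normalized_oscillation hlim hX
  refine ⟨?_, ?_, ?_⟩
  · filter_upwards [key] with ω hω
    -- The two-sided bound on `|increment|` and the one-sided visits of the signed increment give
    -- all three limits; here the visits pass to the absolute value.
    refine KolmogorovPermanental.limsup_eq_of_forall_eps (fun ε hε => (hω ε hε).1)
      fun ε hε => (hω ε hε).2.1.mono fun n hn => hn.trans ?_
    exact div_le_div_of_nonneg_right (le_abs_self _) (Real.sqrt_nonneg _)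
  · filter_upwards [key] with ω hω
    refine KolmogorovPermanental.limsup_eq_of_forall_eps
      (fun ε hε => (hω ε hε).1.mono fun n hn => le_trans ?_ hn) fun ε hε => (hω ε hε).2.1
    exact div_le_div_of_nonneg_right (le_abs_self _) (Real.sqrt_nonneg _)
  · filter_upwards [key] with ω hω
    refine KolmogorovPermanental.liminf_eq_of_forall_eps
      (fun ε hε => (hω ε hε).1.mono fun n hn => ?_) fun ε hε => (hω ε hε).2.2
    have h1 := div_le_div_of_nonneg_right (neg_abs_le (X (KolmogorovPermanental.invPt n) ω
      - X KolmogorovPermanental.zeroPt ω)) (Real.sqrt_nonneg (lam n * Real.log n))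
    rw [neg_div] at h1
    linarith
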